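/- Let $\mathbb K$ be an algebraically closed field of characteristic different from $2$, let $n\ge 2$, let $\mathfrak g=\mathfrak{sp}_{2n}(\mathbb K)$, and let $e\in\mathfrak g$ be a nilpotent element (i.e. nilpotent as a $2n\times 2n$ matrix). Let $\mathfrak g_e=\{x\in\mathfrak g : [e,x]=0\}$ be the centraliser of $e$ in $\mathfrak g$. For $\gamma\in\mathfrak g_e^*$ put $\mathfrak g_e^\gamma=\{x\in\mathfrak g_e : \gamma([x,y])=0 \text{ for all } y\in\mathfrak g_e\}$, and let $$\operatorname{ind}\mathfrak g_e=\min_{\gamma\in\mathfrak g_e^*}\dim\mathfrak g_e^\gamma,\qquad (\mathfrak g_e^*)_{\rm sing}=\{\gamma\in\mathfrak g_e^* : \dim\mathfrak g_e^\gamma>\operatorname{ind}\mathfrak g_e\}.$$ Then $(\mathfrak g_e^*)_{\rm sing}$ has codimension at least $2$ in $\mathfrak g_e^*$ with respect to the Zariski topology (the empty set having codimension $\infty$). -/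

import Mathlib

attribute [local instance 100] LieRing.ofAssociativeRing

noncomputable section

namespace LinearFunctions

section Lie

variable (K : Type*) [Field K] {L : Type*} [LieRing L] [LieAlgebra K L]

/-- The centraliser of an element `e` in a Lie algebra `L`. -/
def centraliser (e : L) : LieSubalgebra K L where
  carrier := {x | ⁅e, x⁆ = 0}
  zero_mem' := lie_zero e
  add_mem' := by
    intro x y hx hy
    change ⁅e, x⁆ = 0 at hx
    change ⁅e, y⁆ = 0 at hy
    change ⁅e, x + y⁆ = 0
    rw [lie_add, hx, hy, add_zero]
  smul_mem' := by
    intro c x hx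
    change ⁅e, x⁆ = 0 at hx
    change ⁅e, c • x⁆ = 0
    rw [lie_smul, hx, smul_zero]
  lie_mem' := by
    intro x y hx hy
    change ⁅e, x⁆ = 0 at hx
    change ⁅e, y⁆ = 0 at hy
    change ⁅e, ⁅x, y⁆⁆ = 0
    rw [leibniz_lie, hx, hy, zero_lie, lie_zero, add_zero]

variable {K}

/-- The stabiliser of a linear function `γ` on a Lie algebra `L` under the coadjoint action:
all `x` with `γ ⁅x, y⁆ = 0` for every `y`. -/
def stabiliser (γ : Module.Dual K L) : Submodule K L where
  carrier := {x | ∀ y : L, γ ⁅x, y⁆ = 0}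
  zero_mem' := by
    intro y
    rw [zero_lie, map_zero]
  add_mem' := by
    intro x x' hx hx' y
    rw [add_lie, map_add, hx y, hx' y, add_zero]
  smul_mem' := by
    intro c x hx y
    rw [smul_lie, map_smul, hx y, smul_zero]

variable (K L)

/-- The index of a (finite-dimensional) Lie algebra: the minimal dimension of the stabiliser of a
linear function. -/
def index : ℕ :=
  ⨅ γ : Module.Dual K L, Module.finrank K (stabiliser γ)

/-- The singular linear functions on a (finite-dimensional) Lie algebra: those whose stabiliser has
dimension larger than the index. -/
def singularLocus : Set (Module.Dual K L) :=
  {γ | index K L < Module.finrank K (stabiliser γ)}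

end Lie

section Zariski

variable (K V : Type*) [Field K] [AddCommGroup V] [Module K V]

/-- The point of the spectrum of the symmetric algebra of `V` (the algebra of polynomial functions
on the dual space of `V`) given by a linear function `γ`: the kernel of evaluation at `γ`. -/
def toSpectrum (γ : Module.Dual K V) : PrimeSpectrum (SymmetricAlgebra K V) :=
  ⟨RingHom.ker (SymmetricAlgebra.lift γ : SymmetricAlgebra K V →ₐ[K] K), RingHom.ker_isPrime _⟩

/-- The Zariski topology on the dual space of `V`. -/
@[reducible] def zariskiTopology : TopologicalSpace (Module.Dual K V) :=
  TopologicalSpace.induced (toSpectrum K V) inferInstance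

/-- The Zariski closed subsets of the dual space are the common zero loci of sets of polynomial
functions, that is, of elements of the symmetric algebra of `V`. -/
theorem isClosed_zariski_iff (Z : Set (Module.Dual K V)) :
    @IsClosed _ (zariskiTopology K V) Z ↔ ∃ S : Set (SymmetricAlgebra K V),
      Z = {γ | ∀ f ∈ S, SymmetricAlgebra.lift γ f = 0} := by
  rw [isClosed_induced_iff]
  constructor
  · rintro ⟨t, ht, rfl⟩
    obtain ⟨S, rfl⟩ := (PrimeSpectrum.isClosed_iff_zeroLocus t).1 ht
    exact ⟨S, rfl⟩
  · rintro ⟨S, rfl⟩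
    exact ⟨PrimeSpectrum.zeroLocus S, PrimeSpectrum.isClosed_zeroLocus S, rfl⟩

variable {K V}

/-- The codimension of a subset `Z` of the dual space of `V` in the Zariski topology: the infimum,
over all irreducible closed subsets `Y` of the closure of `Z`, of the supremum of the lengths of
the chains `Y = Y₀ ⊂ Y₁ ⊂ ⋯ ⊂ Yₘ` of irreducible closed subsets of the dual space.
(The empty set has codimension `⊤`.) -/
def zariskiCodim (Z : Set (Module.Dual K V)) : ℕ∞ :=
  letI := zariskiTopology K V
  ⨅ Y : TopologicalSpace.IrreducibleCloseds (Module.Dual K V),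
    ⨅ _ : (Y : Set (Module.Dual K V)) ⊆ closure Z, Order.coheight Y

end Zariski

end LinearFunctions

end

/-! The singular locus is the common zero set of the minors of size `dim - index` of the matrix of
brackets, so it is determinantal. If a hypersurface `f = 0` lay inside it, `f` would divide each
minor. Suppose some minor is nonzero at `α`. Along the line `t • α + β` that minor has the full
degree, hence so does its factor `f`, and `f` has a root on the line. It is therefore enough to find
a plane of linear functions whose nonzero elements are all regular
(`two_le_zariskiCodim_singularLocus`).

The index is bounded below by `n`. Every element of `sp` has a centraliser of dimension at least
`n`, by deforming it to an element whose powers are independent. Vinberg's inequality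
(`le_finrank_ker_restrict`), applied to the commutator forms of the pencil `e + s y`, carries the
bound over to stabilisers in the centraliser of `e`. The same argument bounds by `n` from below the
analogous kernel on self-adjoint matrices commuting with `e`.

For the upper bound, pass to the commutant of `e` in all endomorphisms. For a linear function
vanishing on self-adjoint elements, the two eigenspaces of the adjoint involution are orthogonal for
the commutator form. The kernel in the full commutant thus contains the direct sum of the symplectic
and the self-adjoint kernels. If it has dimension at most `2n`, the self-adjoint part uses up `n`,
leaving at most `n` for the symplectic part (`finrank_centralKernel_le`).

The plane comes from a symplectic Jordan basis of `e`. A coefficient matrix on the chain generators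
defines a linear function; elements of its kernel killed by `e` satisfy a truncated Sylvester
equation (`sylvester_equation`). Take `α` diagonal, with entries separated by their squares, and `β`
such that every `t • α + β` is Hessenberg with nonzero superdiagonal. In both cases the equation
together with one linear condition `Φ ∘ x = 0` forces `x = 0`, so `x ↦ Φ ∘ x` embeds the kernel into
the dual of the `2n`-dimensional space. -/

namespace LinearFunctions

open Module Matrix

/-! ### Zariski topology on a dual space and the codimension criterion. -/

section Zariski

variable {K V κ : Type*} [Field K] [AddCommGroup V] [Module K V]

theorem lift_eq_aeval_equivMvPolynomial (b : Basis κ K V) (γ : Dual K V)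
    (f : SymmetricAlgebra K V) :
    SymmetricAlgebra.lift γ f =
      MvPolynomial.aeval (fun i => γ (b i)) (SymmetricAlgebra.equivMvPolynomial b f) := by
  have : SymmetricAlgebra.lift γ = (MvPolynomial.aeval (fun i => γ (b i))).comp
      (SymmetricAlgebra.equivMvPolynomial b).toAlgHom := by
    apply SymmetricAlgebra.algHom_ext
    apply b.ext
    intro i
    simp
  rw [this]
  rfl

theorem isClosed_zariski_iff_mvPolynomial (b : Basis κ K V) (Z : Set (Dual K V)) :
    @IsClosed _ (zariskiTopology K V) Z ↔ ∃ S : Set (MvPolynomial κ K),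
      Z = {γ | ∀ f ∈ S, MvPolynomial.aeval (fun i => γ (b i)) f = 0} := by
  rw [isClosed_zariski_iff]
  constructor
  · rintro ⟨S, rfl⟩
    refine ⟨SymmetricAlgebra.equivMvPolynomial b '' S, ?_⟩
    ext γ
    simp [lift_eq_aeval_equivMvPolynomial b]
  · rintro ⟨S, rfl⟩
    refine ⟨(SymmetricAlgebra.equivMvPolynomial b).symm '' S, ?_⟩
    ext γ
    simp [lift_eq_aeval_equivMvPolynomial b]

/-- The closed subset of the dual space cut out by a prime ideal is irreducible. -/
theorem isIrreducible_zariski_zeroLocus [IsAlgClosed K] [Finite κ] (b : Basis κ K V)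
    (P : Ideal (MvPolynomial κ K)) [hP : P.IsPrime] :
    @IsIrreducible _ (zariskiTopology K V)
      {γ | ∀ f ∈ P, MvPolynomial.aeval (fun i => γ (b i)) f = 0} := by
  let _ := zariskiTopology K V
  have key : ∀ f : MvPolynomial κ K,
      (∀ γ : Dual K V, (∀ p ∈ P, MvPolynomial.aeval (fun i => γ (b i)) p = 0) →
        MvPolynomial.aeval (fun i => γ (b i)) f = 0) → f ∈ P := by
    intro f hf
    rw [← MvPolynomial.IsPrime.vanishingIdeal_zeroLocus (K := K) P]
    intro x hx
    have := hf (b.constr K x)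
    simp only [Basis.constr_basis] at this
    exact this hx
  constructor
  · by_contra hne
    rw [Set.not_nonempty_iff_eq_empty] at hne
    apply hP.ne_top
    rw [Ideal.eq_top_iff_one]
    refine key 1 fun γ hγ => ?_
    have : γ ∈ (∅ : Set (Dual K V)) := hne ▸ hγ
    exact this.elim
  · rw [isPreirreducible_iff_isClosed_union_isClosed]
    intro A B hA hB hAB
    obtain ⟨S, rfl⟩ := (isClosed_zariski_iff_mvPolynomial b A).1 hA
    obtain ⟨T, rfl⟩ := (isClosed_zariski_iff_mvPolynomial b B).1 hB
    by_contra! hcon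
    obtain ⟨h1, h2⟩ := hcon
    have hS : ∃ f ∈ S, f ∉ P := by
      by_contra! h
      exact h1 fun γ hγ f hf => hγ f (h f hf)
    have hT : ∃ f ∈ T, f ∉ P := by
      by_contra! h
      exact h2 fun γ hγ f hf => hγ f (h f hf)
    obtain ⟨f, hfS, hfP⟩ := hS
    obtain ⟨g, hgT, hgP⟩ := hT
    have hfg : f * g ∈ P := by
      refine key _ fun γ hγ => ?_
      rw [map_mul]
      rcases hAB hγ with h | h
      · rw [h f hfS, zero_mul]
      · rw [h g hgT, mul_zero]
    exact (hP.mem_or_mem hfg).elim hfP hgP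

/-- The ideal of polynomials vanishing on an irreducible set is prime. -/
theorem isPrime_vanishingIdeal_of_isIrreducible (b : Basis κ K V) (Y : Set (Dual K V))
    (hY : @IsIrreducible _ (zariskiTopology K V) Y) :
    ∃ I : Ideal (MvPolynomial κ K), I.IsPrime ∧
      ∀ f, f ∈ I ↔ ∀ γ ∈ Y, MvPolynomial.aeval (fun i => γ (b i)) f = 0 := by
  let _ := zariskiTopology K V
  refine ⟨MvPolynomial.vanishingIdeal K ((fun γ : Dual K V => fun i => γ (b i)) '' Y), ?_, ?_⟩
  swap
  · intro f
    simp
  · refine Ideal.isPrime_iff.2 ⟨?_, ?_⟩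
    · rw [Ne, Ideal.eq_top_iff_one]
      obtain ⟨γ, hγ⟩ := hY.nonempty
      simp only [MvPolynomial.mem_vanishingIdeal_iff, Set.forall_mem_image, map_one]
      exact fun h => one_ne_zero (h hγ)
    · intro f g hfg
      simp only [MvPolynomial.mem_vanishingIdeal_iff, Set.forall_mem_image, map_mul,
        mul_eq_zero] at hfg ⊢
      have cl : ∀ f : MvPolynomial κ K,
          IsClosed {γ : Dual K V | MvPolynomial.aeval (fun i => γ (b i)) f = 0} := fun f =>
        (isClosed_zariski_iff_mvPolynomial b _).2 ⟨{f}, by simp⟩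
      exact isPreirreducible_iff_isClosed_union_isClosed.1 hY.isPreirreducible _ _ (cl f) (cl g)
        fun γ hγ => hfg hγ

/-- The vectors of `V`, seen as linear polynomials in the coordinates on the dual space. -/
noncomputable def linearForm (b : Basis κ K V) : V →ₗ[K] MvPolynomial κ K :=
  b.constr K MvPolynomial.X

theorem aeval_det_constr {ι R : Type*} [Fintype ι] [DecidableEq ι] [CommRing R] [Algebra K R]
    (b : Basis κ K V) (A : Matrix ι ι V) (x : κ → R) :
    MvPolynomial.aeval x (A.map (linearForm b)).det =
      (A.map (b.constr K x)).det := by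
  rw [AlgHom.map_det]
  congr 1
  ext i j
  have : (MvPolynomial.aeval x).toLinearMap ∘ₗ linearForm b
      = b.constr K x := b.ext fun i => by simp [linearForm]
  simpa using congrArg (fun φ => φ (A i j)) this

/-- Each term is a product of `r` linear forms. Against this bound, a determinant reaching degree
`r` on a line has no factor that loses degree there. -/
theorem totalDegree_det_constr_le {r : ℕ} [Finite κ] (b : Basis κ K V)
    (A : Matrix (Fin r) (Fin r) V) :
    (A.map (linearForm b)).det.totalDegree ≤ r := by
  have := Fintype.ofFinite κ
  have hlin : ∀ v, (linearForm b v).totalDegree ≤ 1 := by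
    intro v
    rw [linearForm, Basis.constr_apply_fintype]
    refine MvPolynomial.totalDegree_finsetSum_le fun i _ => ?_
    exact (MvPolynomial.totalDegree_smul_le _ _).trans (MvPolynomial.totalDegree_X i).le
  rw [Matrix.det_apply]
  refine MvPolynomial.totalDegree_finsetSum_le fun σ _ => ?_
  refine (MvPolynomial.totalDegree_smul_le _ _).trans ?_
  refine (MvPolynomial.totalDegree_finsetProd _ _).trans ?_
  refine (Finset.sum_le_sum fun i _ => hlin _).trans ?_
  simp

/-- A determinantal subset of the dual space which a plane of linear functions meets at most in
`0` has codimension at least two. -/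
theorem two_le_zariskiCodim [IsAlgClosed K] [FiniteDimensional K V] {ι : Type*} {r : ℕ}
    (A : ι → Matrix (Fin r) (Fin r) V) {Z : Set (Dual K V)}
    (hZ : ∀ γ, γ ∈ Z ↔ ∀ i, ((A i).map γ).det = 0) (α β : Dual K V)
    (hα : α ∉ Z) (hβ : ∀ t : K, t • α + β ∉ Z) : 2 ≤ zariskiCodim Z := by
  classical
  let _ := zariskiTopology K V
  let b := finBasis K V
  let Δ : ι → MvPolynomial (Fin (finrank K V)) K := fun i =>
    ((A i).map (linearForm b)).det
  have hΔ : ∀ i (γ : Dual K V), MvPolynomial.aeval (fun k => γ (b k)) (Δ i) = ((A i).map γ).det := by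
    intro i γ
    simp only [Δ]
    rw [aeval_det_constr]
    congr 2
    exact congrArg _ (b.ext fun k => by simp)
  have hZc : IsClosed Z := by
    refine (isClosed_zariski_iff_mvPolynomial b _).2 ⟨Set.range Δ, ?_⟩
    ext γ
    rw [hZ, Set.mem_ofPred_eq, Set.forall_mem_range]
    exact forall_congr' fun i => by rw [hΔ]
  unfold zariskiCodim
  refine le_iInf fun Y => le_iInf fun hY => ?_
  rw [hZc.closure_eq] at hY
  obtain ⟨I, hI, hIm⟩ := isPrime_vanishingIdeal_of_isIrreducible b Y Y.isIrreducible'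
  obtain ⟨i, hi⟩ : ∃ i, ((A i).map α).det ≠ 0 := by
    rw [hZ] at hα
    push Not at hα
    exact hα
  have hΔne : Δ i ≠ 0 := fun h => hi (by rw [← hΔ, h, map_zero])
  have hΔI : Δ i ∈ I := by
    rw [hIm]
    intro γ hγ
    rw [hΔ]
    exact (hZ γ).1 (hY hγ) i
  -- Unique factorisation: a nonzero prime ideal of a polynomial ring contains a prime element. This
  -- gives the chain `Y < {f = 0} <` whole space.
  obtain ⟨f, hfI, hf⟩ := hI.exists_mem_prime_of_ne_bot
    (fun h => hΔne (by rw [h] at hΔI; exact hΔI))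
  have hfP : (Ideal.span {f}).IsPrime := (Ideal.span_singleton_prime hf.ne_zero).2 hf
  have mkc : ∀ P : Ideal (MvPolynomial (Fin (finrank K V)) K),
      IsClosed {γ : Dual K V | ∀ f ∈ P, MvPolynomial.aeval (fun i => γ (b i)) f = 0} := fun P =>
    (isClosed_zariski_iff_mvPolynomial b _).2 ⟨P, rfl⟩
  let Y₁ : TopologicalSpace.IrreducibleCloseds (Dual K V) :=
    ⟨_, isIrreducible_zariski_zeroLocus b (Ideal.span {f}), mkc _⟩
  let Y₂ : TopologicalSpace.IrreducibleCloseds (Dual K V) :=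
    ⟨_, isIrreducible_zariski_zeroLocus b ⊥, mkc _⟩
  have hY₁ : ∀ γ, γ ∈ Y₁ ↔ MvPolynomial.aeval (fun i => γ (b i)) f = 0 := by
    intro γ
    constructor
    · intro h
      exact h f (Ideal.mem_span_singleton_self f)
    · intro h p hp
      obtain ⟨q, rfl⟩ := Ideal.mem_span_singleton.1 hp
      rw [map_mul, h, zero_mul]
  have hY₂ : ∀ γ, γ ∈ Y₂ := by
    intro γ p hp
    rw [(Submodule.mem_bot _).1 hp, map_zero]
  have hle₁ : Y ≤ Y₁ := fun γ hγ => (hY₁ γ).2 ((hIm f).1 hfI γ hγ)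
  have hlt₂ : Y₁ < Y₂ := by
    refine lt_of_le_of_ne (fun γ _ => hY₂ γ) fun h => ?_
    apply hf.ne_zero
    have : f ∈ MvPolynomial.vanishingIdeal K (MvPolynomial.zeroLocus K
        (⊥ : Ideal (MvPolynomial (Fin (finrank K V)) K))) := by
      intro x _
      have h1 : b.constr K x ∈ Y₁ := h ▸ hY₂ _
      have := (hY₁ _).1 h1
      simpa using this
    rw [MvPolynomial.IsPrime.vanishingIdeal_zeroLocus] at this
    exact this
  have hlt₁ : Y < Y₁ := by
    refine lt_of_le_of_ne hle₁ fun h => ?_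
    -- If `Y` were the whole hypersurface, the Nullstellensatz would make `f` divide the minor.
    have hfΔ : f ∣ Δ i := by
      have : Δ i ∈ MvPolynomial.vanishingIdeal K (MvPolynomial.zeroLocus K (Ideal.span {f})) := by
        intro x hx
        have h1 : b.constr K x ∈ Y := by
          rw [h, hY₁]
          simpa using hx f (Ideal.mem_span_singleton_self f)
        have := (hIm _).1 hΔI _ h1
        simpa using this
      rw [MvPolynomial.IsPrime.vanishingIdeal_zeroLocus] at this
      exact Ideal.mem_span_singleton.1 this
    obtain ⟨g, hg⟩ := hfΔ
    let x : Fin (finrank K V) → Polynomial K := fun k =>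
      Polynomial.X * Polynomial.C (α (b k)) + Polynomial.C (β (b k))
    have hx : ∀ k, (x k).natDegree ≤ 1 := by
      intro k
      simp only [x]
      compute_degree
    have hxΔ : MvPolynomial.aeval x (Δ i) = ((Polynomial.X : Polynomial K) •
        ((A i).map α).map Polynomial.C + ((A i).map β).map Polynomial.C).det := by
      simp only [Δ]
      rw [aeval_det_constr]
      congr 1
      ext1 k l
      have : b.constr K x = (Polynomial.X : Polynomial K) •
          ((Algebra.linearMap K (Polynomial K)) ∘ₗ α) +
          (Algebra.linearMap K (Polynomial K)) ∘ₗ β := b.ext fun k => by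
        rw [Basis.constr_basis]
        simp [x, Polynomial.algebraMap_eq]
      rw [Matrix.map_apply, this]
      simp [Polynomial.algebraMap_eq]
    -- The coefficient of `X ^ r` in the determinant on the line `X α + β` is its value at `α`,
    -- which is nonzero.
    have hdegΔ : r ≤ (MvPolynomial.aeval x (Δ i)).natDegree := by
      apply Polynomial.le_natDegree_of_ne_zero
      rw [hxΔ]
      have := Polynomial.coeff_det_X_add_C_card ((A i).map α) ((A i).map β)
      rw [Fintype.card_fin] at this
      rw [this]
      exact hi
    have hgne : g ≠ 0 := fun h => hΔne (by rw [hg, h, mul_zero])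
    have h1 : f.totalDegree + g.totalDegree ≤ r := by
      rw [← MvPolynomial.totalDegree_mul_of_isDomain hf.ne_zero hgne, ← hg]
      exact totalDegree_det_constr_le b (A i)
    have h2 : r ≤ (MvPolynomial.aeval x f).natDegree + (MvPolynomial.aeval x g).natDegree := by
      rw [hg, map_mul] at hdegΔ
      exact hdegΔ.trans Polynomial.natDegree_mul_le
    have h3 := MvPolynomial.aeval_natDegree_le g le_rfl x hx
    have h4 : 0 < f.totalDegree := by
      rw [Nat.pos_iff_ne_zero, Ne, MvPolynomial.totalDegree_eq_zero_iff_eq_C]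
      intro h
      apply hf.not_isUnit
      rw [h]
      have hc : MvPolynomial.coeff 0 f ≠ 0 := fun h0 => hf.ne_zero (by rw [h, h0, map_zero])
      exact (isUnit_iff_ne_zero.2 hc).map MvPolynomial.C
    -- Were `f` constant on the line, the cofactor `g`, of total degree less than `r`, would have to
    -- supply degree `r` alone. The zero polynomial has degree `⊥`, so it needs no separate case.
    have h5 : (MvPolynomial.aeval x f).degree ≠ 0 := by
      intro h
      have h6 : (MvPolynomial.aeval x f).natDegree = 0 := Polynomial.natDegree_eq_of_degree_eq_some h
      omega
    obtain ⟨t, ht⟩ := IsAlgClosed.exists_root _ h5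
    have hmem : t • α + β ∈ Y := by
      rw [h, hY₁]
      have : ((Polynomial.aeval t).comp (MvPolynomial.aeval x)) =
          MvPolynomial.aeval (R := K) (fun i => (t • α + β) (b i)) :=
        MvPolynomial.algHom_ext fun k => by
          simp only [x, AlgHom.comp_apply, MvPolynomial.aeval_X, map_add, map_mul,
            Polynomial.aeval_X, Polynomial.aeval_C, LinearMap.add_apply, LinearMap.smul_apply,
            smul_eq_mul, Algebra.algebraMap_self, RingHom.id_apply]
      rw [← this]
      simpa using ht
    exact hβ t (hY hmem)
  have c1 := Order.coheight_add_one_le hlt₁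
  have c2 := Order.coheight_add_one_le hlt₂
  calc (2 : ℕ∞) = 0 + 1 + 1 := by norm_num
    _ ≤ Order.coheight Y₂ + 1 + 1 := by gcongr; exact zero_le
    _ ≤ Order.coheight Y₁ + 1 := by gcongr
    _ ≤ Order.coheight Y := c1

end Zariski

/-! ### Rank of a bilinear form through minors. -/

section Minors

variable {K V W : Type*} [Field K] [AddCommGroup V] [Module K V] [AddCommGroup W] [Module K W]

theorem exists_linearIndependent_comp_iff_le_finrank_range [FiniteDimensional K V]
    (B : V →ₗ[K] W) (r : ℕ) :
    (∃ u : Fin r → V, LinearIndependent K fun i => B (u i)) ↔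
      r ≤ finrank K (LinearMap.range B) := by
  constructor
  · rintro ⟨u, hli⟩
    have h1 := finrank_span_eq_card hli
    rw [Fintype.card_fin] at h1
    rw [← h1]
    apply Submodule.finrank_mono
    rw [Submodule.span_le]
    rintro _ ⟨i, rfl⟩
    exact ⟨u i, rfl⟩
  · intro h
    obtain ⟨f, hf⟩ := exists_linearIndependent_of_le_finrank h
    choose u hu using fun i => LinearMap.mem_range.1 (f i).2
    refine ⟨u, ?_⟩
    simp only [hu]
    exact hf.map' (LinearMap.range B).subtype (Submodule.ker_subtype _)

theorem exists_det_ne_zero_iff_le_finrank_range [FiniteDimensional K V] [FiniteDimensional K W]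
    (B : V →ₗ[K] Dual K W) (r : ℕ) :
    (∃ (u : Fin r → V) (v : Fin r → W), (Matrix.of fun i j => B (u i) (v j)).det ≠ 0) ↔
      r ≤ finrank K (LinearMap.range B) := by
  constructor
  · rintro ⟨u, v, h⟩
    have hli : LinearIndependent K fun i => B (u i) := by
      rw [Fintype.linearIndependent_iff]
      intro c hc
      have h0 : Matrix.vecMul c (Matrix.of fun i j => B (u i) (v j)) = 0 := by
        ext j
        have := congrArg (fun φ : Dual K W => φ (v j)) hc
        simpa [Matrix.vecMul, dotProduct] using this
      exact fun i => congrFun (Matrix.eq_zero_of_vecMul_eq_zero h h0) i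
    exact (exists_linearIndependent_comp_iff_le_finrank_range B r).1 ⟨u, hli⟩
  · intro h
    obtain ⟨u, hf'⟩ := (exists_linearIndependent_comp_iff_le_finrank_range B r).2 h
    have hF : Function.Injective (Fintype.linearCombination K fun i => B (u i)) :=
      linearIndependent_iff_injective_fintypeLinearCombination.1 hf'
    -- Independent functionals `B (u i)` have a dual family in `W`, by reflexivity; the
    -- corresponding minor is the identity matrix.
    have hs := LinearMap.dualMap_surjective_of_injective hF
    choose g hg using fun j : Fin r => hs (LinearMap.proj j)
    refine ⟨u, fun j => (evalEquiv K W).symm (g j), ?_⟩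
    have : (Matrix.of fun i j => B (u i) ((evalEquiv K W).symm (g j))) = 1 := by
      ext i j
      have h1 := congrArg (fun φ => φ (Pi.single i (1 : K))) (hg j)
      have h2 : B (u i) ((evalEquiv K W).symm (g j)) = g j (B (u i)) := by simp
      rw [Matrix.of_apply, h2, Matrix.one_apply]
      simpa [Fintype.linearCombination_apply_single, Pi.single_apply, eq_comm] using h1
    rw [this, Matrix.det_one]
    exact one_ne_zero

end Minors

/-! ### Stabilisers as kernels, and the singular locus as a determinantal set. -/

section Lie

variable {K L : Type*} [Field K] [LieRing L] [LieAlgebra K L]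

/-- The bilinear form `(x, y) ↦ γ ⁅x, y⁆`. -/
def lieForm (γ : Dual K L) : L →ₗ[K] Dual K L :=
  (LieModule.toEnd K L L : L →ₗ[K] End K L).compr₂ γ

theorem ker_lieForm (γ : Dual K L) : LinearMap.ker (lieForm γ) = stabiliser γ := by
  ext x
  rw [LinearMap.mem_ker, LinearMap.ext_iff]
  rfl

theorem index_le (γ : Dual K L) : index K L ≤ finrank K (stabiliser γ) :=
  ciInf_le (OrderBot.bddBelow _) γ

/-- If a plane of linear functions meets the singular locus at most in `0`, then the singular
locus has codimension at least two. -/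
theorem two_le_zariskiCodim_singularLocus [IsAlgClosed K] [FiniteDimensional K L]
    (α β : Dual K L) (hα : finrank K (stabiliser α) ≤ index K L)
    (hβ : ∀ t : K, finrank K (stabiliser (t • α + β)) ≤ index K L) :
    2 ≤ zariskiCodim (singularLocus K L) := by
  refine two_le_zariskiCodim (r := finrank K L - index K L)
    (fun (p : (Fin _ → L) × (Fin _ → L)) => Matrix.of fun i j => ⁅p.1 i, p.2 j⁆) ?_ α β
    (not_lt.2 hα) (fun t => not_lt.2 (hβ t))
  intro γ
  have h1 := exists_det_ne_zero_iff_le_finrank_range (lieForm γ) (finrank K L - index K L)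
  have h2 := LinearMap.finrank_range_add_finrank_ker (lieForm γ)
  rw [ker_lieForm] at h2
  have h3 := index_le γ
  have h4 : γ ∈ singularLocus K L ↔
      ¬ finrank K L - index K L ≤ finrank K (LinearMap.range (lieForm γ)) := by
    change index K L < finrank K (stabiliser γ) ↔ _
    omega
  rw [h4, ← h1]
  push Not
  exact ⟨fun h p => h p.1 p.2, fun h u v => h (u, v)⟩

end Lie

/-! ### Semicontinuity of kernels in a pencil and Vinberg's inequality. -/

section Semicontinuity

variable {K V W : Type*} [Field K] [Infinite K] [AddCommGroup V] [Module K V]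
  [FiniteDimensional K V] [AddCommGroup W] [Module K W] [FiniteDimensional K W]

/-- On a pencil of bilinear forms the dimension of the kernel is, with finitely many exceptions,
at most the dimension at a given point. -/
theorem exists_finrank_ker_add_smul_le (X Y : V →ₗ[K] Dual K W) (F : Finset K) :
    ∃ s ∉ F, finrank K (LinearMap.ker (X + s • Y)) ≤ finrank K (LinearMap.ker X) := by
  classical
  obtain ⟨u, v, h⟩ := (exists_det_ne_zero_iff_le_finrank_range X _).2 le_rfl
  let X₀ := Matrix.of fun i j => X (u i) (v j)
  let Y₀ := Matrix.of fun i j => Y (u i) (v j)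
  let p := ((Polynomial.X : Polynomial K) • Y₀.map Polynomial.C + X₀.map Polynomial.C).det
  have hp : p ≠ 0 := by
    intro h0
    have := Polynomial.coeff_det_X_add_C_zero Y₀ X₀
    change p.coeff 0 = _ at this
    rw [h0, Polynomial.coeff_zero] at this
    exact h this.symm
  obtain ⟨s, hs⟩ := Infinite.exists_notMem_finset (p.roots.toFinset ∪ F)
  rw [Finset.mem_union, not_or, Multiset.mem_toFinset, Polynomial.mem_roots hp] at hs
  refine ⟨s, hs.2, ?_⟩
  have hdet : (Matrix.of fun i j => (X + s • Y) (u i) (v j)).det ≠ 0 := by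
    intro h0
    apply hs.1
    rw [Polynomial.IsRoot.def, ← h0, ← Polynomial.coe_evalRingHom, RingHom.map_det]
    congr 1
    ext i j
    simp [X₀, Y₀, add_comm, mul_comm s]
  have h1 := (exists_det_ne_zero_iff_le_finrank_range (X + s • Y) _).1 ⟨u, v, hdet⟩
  have h2 := LinearMap.finrank_range_add_finrank_ker (X + s • Y)
  have h3 := LinearMap.finrank_range_add_finrank_ker X
  omega

/-- Vinberg's inequality: if almost all forms of the pencil `A + s B` have kernels of dimension at
least `n`, and `A` is skew-symmetric, then so has the restriction of `B` to the kernel of `A`. -/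
theorem le_finrank_ker_restrict (A B : V →ₗ[K] Dual K V) (hA : ∀ x y, A x y = -A y x) (n : ℕ)
    (F : Finset K) (h : ∀ s ∉ F, n ≤ finrank K (LinearMap.ker (A + s • B)))
    (N : Submodule K V) (hN : ∀ x, x ∈ N ↔ A x = 0 ∧ ∀ y, A y = 0 → B x y = 0) :
    n ≤ finrank K N := by
  classical
  obtain ⟨C, hC⟩ := (LinearMap.ker A).exists_isCompl
  let P : V →ₗ[K] V := (LinearMap.ker A).subtype ∘ₗ (LinearMap.ker A).projectionOnto C hC
  have hP : ∀ x, A (P x) = 0 := fun x =>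
    LinearMap.mem_ker.1 ((LinearMap.ker A).projectionOnto C hC x).2
  have hP' : ∀ x, A x = 0 → P x = x := fun x hx => by
    have := Submodule.projectionOnto_apply_left hC ⟨x, hx⟩
    simp only [P, LinearMap.comp_apply]
    exact congrArg Subtype.val this
  -- Rescaling `ker A` by `s` turns `A + s B` into `A + B P + s B (1 - P)`, whose value at `s = 0`
  -- is `A + B P`. Semicontinuity is applied to this pencil; `s = 0` is excluded so that the
  -- rescaling `φ` is invertible.
  obtain ⟨s, hs, hle⟩ := exists_finrank_ker_add_smul_le (A + B ∘ₗ P) (B ∘ₗ (LinearMap.id - P))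
    (insert 0 F)
  rw [Finset.mem_insert, not_or] at hs
  refine (h s hs.2).trans (le_trans ?_ (hle.trans ?_))
  · let φ : V →ₗ[K] V := LinearMap.id - P + s • P
    refine LinearMap.finrank_le_finrank_of_injective (f := φ.restrict (q := LinearMap.ker _) ?_) ?_
    · intro x hx
      rw [LinearMap.mem_ker] at hx ⊢
      have e1 : P (φ x) = s • P x := by
        simp only [φ, LinearMap.add_apply, LinearMap.sub_apply, LinearMap.id_apply,
          LinearMap.smul_apply, map_add, map_sub, map_smul, hP' _ (hP x)]
        abel
      have e2 : φ x - s • P x = x - P x := by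
        simp [φ]
      have e3 : A (φ x) = A x := by
        simp [φ, hP]
      simp only [LinearMap.add_apply, LinearMap.comp_apply, LinearMap.smul_apply,
        LinearMap.sub_apply, LinearMap.id_apply, e1, e2, e3]
      rw [← hx]
      simp only [map_sub, map_smul, smul_sub, LinearMap.add_apply, LinearMap.smul_apply]
      abel
    · rw [LinearMap.injective_restrict_iff]
      rw [Submodule.disjoint_def]
      intro x _ hx
      rw [LinearMap.mem_ker] at hx
      have e1 : P (φ x) = s • P x := by
        simp only [φ, LinearMap.add_apply, LinearMap.sub_apply, LinearMap.id_apply,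
          LinearMap.smul_apply, map_add, map_sub, map_smul, hP' _ (hP x)]
        abel
      rw [hx, map_zero] at e1
      have e2 : P x = 0 := (smul_eq_zero.1 e1.symm).resolve_left hs.1
      simpa [φ, e2] using hx
  -- If `A x + B (P x) = 0`, pairing with `ker A` removes the first term by skew-symmetry, so `P x`
  -- lies in `N`. If moreover `P x = 0`, then `A x = 0` and `x = P x = 0`.
  · refine LinearMap.finrank_le_finrank_of_injective (f := P.restrict (q := N) ?_) ?_
    · intro x hx
      rw [LinearMap.mem_ker] at hx
      refine (hN _).2 ⟨hP x, fun y hy => ?_⟩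
      have := congrArg (fun φ => φ y) hx
      simp only [LinearMap.add_apply, LinearMap.comp_apply, LinearMap.zero_apply] at this
      rw [hA x y, hy] at this
      simpa using this
    · rw [LinearMap.injective_restrict_iff, Submodule.disjoint_def]
      intro x hx hx'
      rw [LinearMap.mem_ker] at hx hx'
      rw [← hP' x (by simpa [hx'] using hx), hx']

end Semicontinuity

/-! ### The adjoint involution, its eigenspaces and commutator forms. -/

section AdjointEigenspaces

variable {n K : Type*} [Fintype n] [DecidableEq n] [Field K]

/-- The eigenspace with eigenvalue `c` of the adjoint involution of the standard symplectic form: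
`c = -1` gives the symplectic Lie algebra and `c = 1` the self-adjoint matrices. -/
def adjointEigenspace (c : K) : Submodule K (Matrix (n ⊕ n) (n ⊕ n) K) where
  carrier := {x | xᵀ * J n K = c • (J n K * x)}
  zero_mem' := by simp
  add_mem' := by
    intro x y hx hy
    change xᵀ * J n K = c • (J n K * x) at hx
    change yᵀ * J n K = c • (J n K * y) at hy
    change (x + y)ᵀ * J n K = c • (J n K * (x + y))
    rw [transpose_add, add_mul, hx, hy, mul_add, smul_add]
  smul_mem' := by
    intro a x hx
    change xᵀ * J n K = c • (J n K * x) at hx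
    change (a • x)ᵀ * J n K = c • (J n K * (a • x))
    rw [transpose_smul, Matrix.smul_mul, hx, Matrix.mul_smul, smul_comm]

theorem mem_adjointEigenspace {c : K} {x : Matrix (n ⊕ n) (n ⊕ n) K} :
    x ∈ adjointEigenspace c ↔ xᵀ * J n K = c • (J n K * x) := Iff.rfl

theorem mem_sp_iff {x : Matrix (n ⊕ n) (n ⊕ n) K} :
    x ∈ LieAlgebra.Symplectic.sp n K ↔ x ∈ adjointEigenspace (-1 : K) := by
  rw [LieAlgebra.Symplectic.sp, mem_skewAdjointMatricesLieSubalgebra,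
    mem_skewAdjointMatricesSubmodule, mem_adjointEigenspace, Matrix.IsSkewAdjoint,
    Matrix.IsAdjointPair, mul_neg, neg_one_smul]

theorem transpose_mul_mul_J {c d : K} {x y : Matrix (n ⊕ n) (n ⊕ n) K}
    (hx : x ∈ adjointEigenspace c) (hy : y ∈ adjointEigenspace d) :
    (x * y)ᵀ * J n K = (c * d) • (J n K * (y * x)) := by
  rw [mem_adjointEigenspace] at hx hy
  rw [transpose_mul, mul_assoc, hx, Matrix.mul_smul, ← mul_assoc, hy, Matrix.smul_mul, smul_smul, mul_assoc]

theorem commutator_mem_adjointEigenspace {c d : K} {x y : Matrix (n ⊕ n) (n ⊕ n) K}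
    (hx : x ∈ adjointEigenspace c) (hy : y ∈ adjointEigenspace d) :
    x * y - y * x ∈ adjointEigenspace (-(c * d)) := by
  rw [mem_adjointEigenspace, transpose_sub, sub_mul, transpose_mul_mul_J hx hy,
    transpose_mul_mul_J hy hx, mul_sub, mul_comm d c, ← smul_sub, neg_smul, ← smul_neg, neg_sub]

theorem pow_mem_adjointEigenspace {c : K} {x : Matrix (n ⊕ n) (n ⊕ n) K}
    (hx : x ∈ adjointEigenspace c) (k : ℕ) : x ^ k ∈ adjointEigenspace (c ^ k) := by
  induction k with
  | zero => simp [mem_adjointEigenspace]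
  | succ k ih =>
    rw [mem_adjointEigenspace, pow_succ, transpose_mul_mul_J ih hx, pow_succ, ← pow_succ',
      ← pow_succ x]

/-- The involution preserves the trace and sends `x * y` to `c * d` times `y * x`, so the trace
equals its own negative. -/
theorem trace_mul_eq_zero_of_mem_adjointEigenspace (h2 : (2 : K) ≠ 0) {c d : K} (hcd : c * d = -1)
    {x y : Matrix (n ⊕ n) (n ⊕ n) K}
    (hx : x ∈ adjointEigenspace c) (hy : y ∈ adjointEigenspace d) : trace (x * y) = 0 := by
  have h := congrArg (fun z => trace (z * J n K)) (transpose_mul_mul_J hx hy)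
  simp only [hcd, neg_one_smul, mul_assoc, J_squared, neg_mul, mul_neg, mul_one, trace_neg,
    trace_transpose] at h
  rw [trace_mul_comm (J n K), mul_assoc, mul_assoc, J_squared] at h
  simp only [mul_neg, mul_one, trace_neg, neg_neg] at h
  rw [trace_mul_comm y x] at h
  have : (2 : K) * trace (x * y) = 0 := by linear_combination -h
  exact (mul_eq_zero.1 this).resolve_left h2

/-- The projections to the eigenspaces of the adjoint involution. -/
def adjointProj (c : K) : Matrix (n ⊕ n) (n ⊕ n) K →ₗ[K] Matrix (n ⊕ n) (n ⊕ n) K where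
  toFun x := (2 : K)⁻¹ • (x - c • (J n K * xᵀ * J n K))
  map_add' x y := by
    rw [transpose_add, mul_add, add_mul, smul_add c, add_sub_add_comm, smul_add]
  map_smul' a x := by
    simp only [transpose_smul, Matrix.mul_smul, Matrix.smul_mul, RingHom.id_apply]
    rw [smul_comm c a, ← smul_sub, smul_comm]

theorem adjointProj_apply (c : K) (x : Matrix (n ⊕ n) (n ⊕ n) K) :
    adjointProj c x = (2 : K)⁻¹ • (x - c • (J n K * xᵀ * J n K)) := rfl

theorem adjointProj_mem {c : K} (hc : c * c = 1) (x : Matrix (n ⊕ n) (n ⊕ n) K) :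
    adjointProj c x ∈ adjointEigenspace c := by
  rw [mem_adjointEigenspace, adjointProj_apply]
  simp only [transpose_smul, transpose_sub, transpose_mul, transpose_transpose, J_transpose,
    Matrix.smul_mul, Matrix.mul_smul]
  rw [smul_comm c (2 : K)⁻¹]
  congr 1
  simp only [sub_mul, mul_sub, smul_sub, smul_smul, hc, one_smul, neg_mul, mul_neg,
    Matrix.smul_mul, Matrix.mul_smul, smul_neg, mul_assoc, J_squared, mul_one, neg_neg]
  simp only [← mul_assoc, J_squared, neg_mul, one_mul, sub_neg_eq_add]
  abel

theorem adjointProj_add (h2 : (2 : K) ≠ 0) (c : K) (x : Matrix (n ⊕ n) (n ⊕ n) K) :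
    adjointProj c x + adjointProj (-c) x = x := by
  rw [adjointProj_apply, adjointProj_apply, ← smul_add, neg_smul, sub_neg_eq_add,
    sub_add_add_cancel, ← two_smul K x, smul_smul, inv_mul_cancel₀ h2, one_smul]

theorem adjointProj_of_mem (h2 : (2 : K) ≠ 0) {c : K} (hc : c * c = 1)
    {x : Matrix (n ⊕ n) (n ⊕ n) K} (hx : x ∈ adjointEigenspace c) : adjointProj c x = x := by
  rw [mem_adjointEigenspace] at hx
  rw [adjointProj_apply, mul_assoc, hx, Matrix.mul_smul, smul_smul, hc, one_smul, ← mul_assoc, J_squared,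
    neg_mul, one_mul, sub_neg_eq_add, ← two_smul K x, smul_smul, inv_mul_cancel₀ h2, one_smul]

/-- The trace form is nondegenerate and the two eigenspaces are orthogonal and span, so it stays
nondegenerate on each of them. -/
theorem eq_zero_of_trace_mul_eq_zero (h2 : (2 : K) ≠ 0) {c : K} (hc : c * c = 1)
    {x : Matrix (n ⊕ n) (n ⊕ n) K} (hx : x ∈ adjointEigenspace c)
    (h : ∀ z ∈ adjointEigenspace (n := n) c, trace (x * z) = 0) : x = 0 := by
  have h' : ∀ z, trace (x * z) = 0 := by
    intro z
    rw [← adjointProj_add h2 c z, mul_add, trace_add, h _ (adjointProj_mem hc z), zero_add]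
    exact trace_mul_eq_zero_of_mem_adjointEigenspace h2 (by rw [mul_neg, hc]) hx
      (adjointProj_mem (by rw [neg_mul_neg, hc]) z)
  ext i j
  simpa [trace_mul_single] using h' (single j i 1)

/-- Linear functions vanishing on the self-adjoint matrices are represented, through the trace
form, by elements of the symplectic Lie algebra. -/
theorem exists_trace_mul_eq (h2 : (2 : K) ≠ 0) (γ : Dual K (Matrix (n ⊕ n) (n ⊕ n) K))
    (hγ : ∀ x ∈ adjointEigenspace (n := n) (1 : K), γ x = 0) :
    ∃ y ∈ adjointEigenspace (n := n) (-1 : K), ∀ x, γ x = trace (y * x) := by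
  let y : Matrix (n ⊕ n) (n ⊕ n) K := of fun i j => γ (single j i 1)
  have hy : ∀ x, γ x = trace (y * x) := by
    intro x
    have : γ = (traceLinearMap _ K K) ∘ₗ LinearMap.mulLeft K y := by
      apply (Matrix.stdBasis K (n ⊕ n) (n ⊕ n)).ext
      rintro ⟨i, j⟩
      simp [stdBasis_eq_single, trace_mul_single, y]
    rw [this]
    rfl
  refine ⟨adjointProj (-1) y, adjointProj_mem (by norm_num) y, fun x => ?_⟩
  have e1 : ∀ z, γ z = γ (adjointProj (-1) z) := by
    intro z
    conv_lhs => rw [← adjointProj_add h2 (-1) z, map_add, neg_neg,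
      hγ _ (adjointProj_mem (by norm_num) z), add_zero]
  have m1 := adjointProj_mem (n := n) (K := K) (c := 1) (by norm_num)
  have m2 := adjointProj_mem (n := n) (K := K) (c := -1) (by norm_num)
  rw [e1, hy]
  conv_lhs => rw [← adjointProj_add h2 (-1) y, neg_neg, add_mul, trace_add,
    trace_mul_eq_zero_of_mem_adjointEigenspace h2 (by norm_num) (m1 y) (m2 x), add_zero]
  conv_rhs => rw [← adjointProj_add h2 (-1) x, neg_neg, mul_add, trace_add,
    trace_mul_eq_zero_of_mem_adjointEigenspace h2 (by norm_num) (m2 y) (m1 x), add_zero]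

/-- The elements of an eigenspace of the adjoint involution that commute with `e` and are
orthogonal, for the form `γ (x * z - z * x)`, to all elements of this kind. -/
def centralKernel (c : K) (e : Matrix (n ⊕ n) (n ⊕ n) K)
    (γ : Dual K (Matrix (n ⊕ n) (n ⊕ n) K)) : Submodule K (Matrix (n ⊕ n) (n ⊕ n) K) where
  carrier := {x | x ∈ adjointEigenspace c ∧ e * x = x * e ∧
    ∀ z ∈ adjointEigenspace (n := n) c, e * z = z * e → γ (x * z - z * x) = 0}
  zero_mem' := by simp
  add_mem' := by
    rintro x y ⟨hx, hx', hx''⟩ ⟨hy, hy', hy''⟩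
    refine ⟨add_mem hx hy, by rw [mul_add, add_mul, hx', hy'], fun z hz hz' => ?_⟩
    rw [add_mul, mul_add, add_sub_add_comm, map_add, hx'' z hz hz', hy'' z hz hz', add_zero]
  smul_mem' := by
    rintro a x ⟨hx, hx', hx''⟩
    refine ⟨Submodule.smul_mem _ _ hx, by rw [Matrix.mul_smul, Matrix.smul_mul, hx'], fun z hz hz' => ?_⟩
    rw [Matrix.smul_mul, Matrix.mul_smul, ← smul_sub, map_smul, hx'' z hz hz', smul_zero]

theorem mem_centralKernel {c : K} {e : Matrix (n ⊕ n) (n ⊕ n) K}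
    {γ : Dual K (Matrix (n ⊕ n) (n ⊕ n) K)} {x : Matrix (n ⊕ n) (n ⊕ n) K} :
    x ∈ centralKernel c e γ ↔ x ∈ adjointEigenspace c ∧ e * x = x * e ∧
    ∀ z ∈ adjointEigenspace (n := n) c, e * z = z * e → γ (x * z - z * x) = 0 := Iff.rfl

/-- The form `(x, z) ↦ trace (ξ * (x * z - z * x))` on an eigenspace of the adjoint involution. -/
def commutatorForm (c : K) (ξ : Matrix (n ⊕ n) (n ⊕ n) K) :
    adjointEigenspace (n := n) c →ₗ[K] Dual K (adjointEigenspace (n := n) c) :=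
  LinearMap.mk₂ K (fun x z => trace (ξ * (x.1 * z.1 - z.1 * x.1)))
    (fun x y z => by
      simp only [Submodule.coe_add, add_mul, mul_add, mul_sub, trace_add, trace_sub]; ring)
    (fun a x z => by
      simp only [Submodule.coe_smul, Matrix.smul_mul, Matrix.mul_smul, mul_sub, trace_smul, trace_sub,
        smul_eq_mul])
    (fun x y z => by
      simp only [Submodule.coe_add, add_mul, mul_add, mul_sub, trace_add, trace_sub]; ring)
    (fun a x z => by
      simp only [Submodule.coe_smul, Matrix.smul_mul, Matrix.mul_smul, mul_sub, trace_smul, trace_sub,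
        smul_eq_mul])

theorem commutatorForm_apply (c : K) (ξ : Matrix (n ⊕ n) (n ⊕ n) K)
    (x z : adjointEigenspace (n := n) c) :
    commutatorForm c ξ x z = trace (ξ * (x.1 * z.1 - z.1 * x.1)) := rfl

theorem commutatorForm_add_smul (c s : K) (ξ η : Matrix (n ⊕ n) (n ⊕ n) K) :
    commutatorForm c (ξ + s • η) = commutatorForm c ξ + s • commutatorForm c η := by
  ext x z
  simp only [LinearMap.add_apply, LinearMap.smul_apply, commutatorForm_apply, add_mul, Matrix.smul_mul,
    trace_add, trace_smul]

theorem commutatorForm_skew (c : K) (ξ : Matrix (n ⊕ n) (n ⊕ n) K)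
    (x z : adjointEigenspace (n := n) c) :
    commutatorForm c ξ x z = - commutatorForm c ξ z x := by
  rw [commutatorForm_apply, commutatorForm_apply, ← trace_neg, ← mul_neg, neg_sub]

/-- By cyclicity the form is `trace ([ξ, x] * z)`, and `[ξ, x]` stays in the eigenspace of `x`,
where the trace form is nondegenerate. Kernels of commutator forms are thus centralisers. -/
theorem commutatorForm_eq_zero_iff (h2 : (2 : K) ≠ 0) {c : K} (hc : c * c = 1)
    {ξ : Matrix (n ⊕ n) (n ⊕ n) K} (hξ : ξ ∈ adjointEigenspace (-1 : K))
    (x : adjointEigenspace (n := n) c) : commutatorForm c ξ x = 0 ↔ ξ * x.1 = x.1 * ξ := by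
  have e : ∀ z, commutatorForm c ξ x z = trace ((ξ * x.1 - x.1 * ξ) * z.1) := by
    intro z
    rw [commutatorForm_apply, mul_sub, sub_mul, trace_sub, trace_sub, ← mul_assoc, ← mul_assoc,
      trace_mul_comm (ξ * z.1), ← mul_assoc]
  constructor
  · intro h
    rw [← sub_eq_zero]
    refine eq_zero_of_trace_mul_eq_zero h2 hc (c := c) ?_ fun z hz => ?_
    · simpa using commutator_mem_adjointEigenspace hξ x.2
    · rw [← e ⟨z, hz⟩, h, LinearMap.zero_apply]
  · intro h
    ext z
    rw [e, h, sub_self, zero_mul, trace_zero, LinearMap.zero_apply]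

end AdjointEigenspaces

/-! ### Generic independence of powers of a symplectic matrix. -/

section Krylov

theorem exists_sq_injective (K : Type*) [Field K] [IsAlgClosed K] :
    ∃ z : ℕ → K, (∀ i, z i ≠ 0) ∧ Function.Injective fun i => z i ^ 2 := by
  have hinf : Infinite K := IsAlgClosed.instInfinite
  let f := (Set.finite_singleton (0 : K)).infinite_compl.natEmbedding
  choose z hz using fun i => IsAlgClosed.exists_pow_nat_eq (f i : K) (n := 2) (by norm_num)
  refine ⟨z, fun i h => (f i).2 ?_, fun i j h => f.injective (Subtype.ext ?_)⟩
  · rw [Set.mem_singleton_iff, ← hz, h, zero_pow two_ne_zero]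
  · rw [← hz, ← hz]
    exact h

variable {R S : Type*} [CommRing R] [CommRing S] {n : ℕ}

/-- The exponents of the Krylov matrix: even ones first. -/
def krylovExponent : Fin n ⊕ Fin n → ℕ := Sum.elim (fun j => 2 * j) fun j => 2 * j + 1

/-- The Krylov matrix of `ζ`, whose columns are the powers of `ζ` applied to `(1, …, 1)`. -/
def krylov (ζ : Matrix (Fin n ⊕ Fin n) (Fin n ⊕ Fin n) R) :
    Matrix (Fin n ⊕ Fin n) (Fin n ⊕ Fin n) R :=
  of fun i j => ((ζ ^ krylovExponent j) *ᵥ 1) i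

theorem map_krylov (f : R →+* S) (ζ : Matrix (Fin n ⊕ Fin n) (Fin n ⊕ Fin n) R) :
    f.mapMatrix (krylov ζ) = krylov (f.mapMatrix ζ) := by
  ext i j
  simp only [krylov, RingHom.mapMatrix_apply, map_apply, of_apply]
  rw [RingHom.map_mulVec, ← RingHom.mapMatrix_apply, map_pow]
  congr 2
  ext k
  simp

theorem linearIndependent_pow_of_det_krylov_ne_zero {K : Type*} [Field K]
    {ζ : Matrix (Fin n ⊕ Fin n) (Fin n ⊕ Fin n) K} (h : (krylov ζ).det ≠ 0) :
    LinearIndependent K fun j : Fin n ⊕ Fin n => ζ ^ krylovExponent j := by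
  have h1 := linearIndependent_cols_of_det_ne_zero h
  let φ : Matrix (Fin n ⊕ Fin n) (Fin n ⊕ Fin n) K →ₗ[K] (Fin n ⊕ Fin n → K) :=
    (mulVecBilin K K).flip 1
  refine LinearIndependent.of_comp φ ?_
  exact h1

theorem diagonal_mem_adjointEigenspace {K : Type*} [Field K] (d : Fin n → K) :
    diagonal (Sum.elim d (-d)) ∈ adjointEigenspace (-1 : K) := by
  rw [mem_adjointEigenspace, diagonal_transpose, ← fromBlocks_diagonal, J, fromBlocks_multiply,
    fromBlocks_multiply, fromBlocks_smul]
  simp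

/-- A dependence is a polynomial vanishing at every `d i` and `-d i`. Its even and odd parts then
vanish at each `d i` separately, and a Vandermonde matrix in the squares finishes. -/
theorem det_krylov_diagonal_ne_zero {K : Type*} [Field K] (h2 : (2 : K) ≠ 0) (d : Fin n → K)
    (hd : ∀ i, d i ≠ 0) (hinj : Function.Injective fun i => d i ^ 2) :
    (krylov (diagonal (Sum.elim d (-d)))).det ≠ 0 := by
  intro h0
  obtain ⟨c, hc, h⟩ := exists_mulVec_eq_zero_iff.2 h0
  apply hc
  have e : ∀ i, (krylov (diagonal (Sum.elim d (-d))) *ᵥ c) i =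
      ∑ j : Fin n, c (Sum.inl j) * (Sum.elim d (-d) i ^ 2) ^ (j : ℕ) +
      Sum.elim d (-d) i * ∑ j : Fin n, c (Sum.inr j) * (Sum.elim d (-d) i ^ 2) ^ (j : ℕ) := by
    intro i
    have hk : ∀ j, krylov (diagonal (Sum.elim d (-d))) i j =
        Sum.elim d (-d) i ^ krylovExponent (n := n) j := by
      intro j
      rw [krylov, of_apply, diagonal_pow, mulVec_diagonal, Pi.one_apply, mul_one, Pi.pow_apply]
    simp only [mulVec, dotProduct, hk, Fintype.sum_sum_type, Finset.mul_sum]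
    congr 1
    · refine Finset.sum_congr rfl fun j _ => ?_
      rw [krylovExponent, Sum.elim_inl, pow_mul, mul_comm]
    · refine Finset.sum_congr rfl fun j _ => ?_
      rw [krylovExponent, Sum.elim_inr, pow_succ, pow_mul]
      ring
  have key : ∀ i, (∑ j : Fin n, c (Sum.inl j) * (d i ^ 2) ^ (j : ℕ)) = 0 ∧
      (∑ j : Fin n, c (Sum.inr j) * (d i ^ 2) ^ (j : ℕ)) = 0 := by
    intro i
    have e1 := e (Sum.inl i)
    have e2 := e (Sum.inr i)
    rw [h] at e1 e2
    simp only [Pi.zero_apply, Sum.elim_inl, Sum.elim_inr, Pi.neg_apply, neg_sq] at e1 e2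
    have e3 : 2 * (∑ j : Fin n, c (Sum.inl j) * (d i ^ 2) ^ (j : ℕ)) = 0 := by
      linear_combination -e1 - e2
    have e4 : (2 * d i) * (∑ j : Fin n, c (Sum.inr j) * (d i ^ 2) ^ (j : ℕ)) = 0 := by
      linear_combination -e1 + e2
    exact ⟨(mul_eq_zero.1 e3).resolve_left h2,
      (mul_eq_zero.1 e4).resolve_left (mul_ne_zero h2 (hd i))⟩
  have hv : (vandermonde fun i => d i ^ 2).det ≠ 0 := det_vandermonde_ne_zero_iff.2 hinj
  have k1 := eq_zero_of_mulVec_eq_zero hv (v := fun j => c (Sum.inl j)) (by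
    ext i
    simpa [mulVec, dotProduct, vandermonde_apply, mul_comm] using (key i).1)
  have k2 := eq_zero_of_mulVec_eq_zero hv (v := fun j => c (Sum.inr j)) (by
    ext i
    simpa [mulVec, dotProduct, vandermonde_apply, mul_comm] using (key i).2)
  ext (j | j)
  · exact congrFun k1 j
  · exact congrFun k2 j

end Krylov

/-! ### Lower bounds for centralisers and for their stabilisers. -/

section LowerBound

variable {K : Type*} [Field K] {n : ℕ}

/-- Even powers of `ζ` are self-adjoint, odd ones are in the symplectic Lie algebra, and all commute
with `ζ`. Each half of the independent powers supplies `n` elements. -/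
theorem le_finrank_ker_commutatorForm_of_krylov (h2 : (2 : K) ≠ 0) {c : K} (hc : c = 1 ∨ c = -1)
    {ζ : Matrix (Fin n ⊕ Fin n) (Fin n ⊕ Fin n) K} (hζ : ζ ∈ adjointEigenspace (-1 : K))
    (h : (krylov ζ).det ≠ 0) : n ≤ finrank K (LinearMap.ker (commutatorForm c ζ)) := by
  have hli := linearIndependent_pow_of_det_krylov_ne_zero h
  have hcc : c * c = 1 := by rcases hc with rfl | rfl <;> norm_num
  obtain ⟨ι, hι, hm⟩ : ∃ ι : Fin n → Fin n ⊕ Fin n, Function.Injective ι ∧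
      ∀ j, ζ ^ krylovExponent (ι j) ∈ adjointEigenspace c := by
    rcases hc with rfl | rfl
    · refine ⟨Sum.inl, Sum.inl_injective, fun j => ?_⟩
      have := pow_mem_adjointEigenspace hζ (2 * j)
      rwa [pow_mul, neg_one_sq, one_pow] at this
    · refine ⟨Sum.inr, Sum.inr_injective, fun j => ?_⟩
      have := pow_mem_adjointEigenspace hζ (2 * j + 1)
      rwa [pow_succ, pow_mul (-1 : K), neg_one_sq, one_pow, one_mul] at this
  let w : Fin n → LinearMap.ker (commutatorForm c ζ) := fun j => ⟨⟨_, hm j⟩,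
    LinearMap.mem_ker.2 ((commutatorForm_eq_zero_iff h2 hcc hζ _).2
      (by rw [← pow_succ, ← pow_succ']))⟩
  have hw : LinearIndependent K w := LinearIndependent.of_comp
    ((adjointEigenspace c).subtype ∘ₗ (LinearMap.ker (commutatorForm c ζ)).subtype)
    (hli.comp ι hι)
  simpa using hw.fintype_card_le_finrank

/-- The centraliser of an element of the symplectic Lie algebra in either eigenspace of the adjoint
involution has dimension at least `n`. -/
theorem le_finrank_ker_commutatorForm [IsAlgClosed K] (h2 : (2 : K) ≠ 0) {c : K} (hc : c = 1 ∨ c = -1)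
    {ξ : Matrix (Fin n ⊕ Fin n) (Fin n ⊕ Fin n) K} (hξ : ξ ∈ adjointEigenspace (-1 : K)) :
    n ≤ finrank K (LinearMap.ker (commutatorForm c ξ)) := by
  classical
  have hinf : Infinite K := IsAlgClosed.instInfinite
  obtain ⟨z, hz, hzi⟩ := exists_sq_injective K
  let d : Fin n → K := fun i => z i
  let h := diagonal (Sum.elim d (-d))
  have hh : h ∈ adjointEigenspace (-1 : K) := diagonal_mem_adjointEigenspace d
  have hkr : (krylov h).det ≠ 0 :=
    det_krylov_diagonal_ne_zero h2 d (fun i => hz i) (fun i j hij => Fin.ext (hzi hij))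
  let q : Polynomial K := (krylov (h.map Polynomial.C + (Polynomial.X : Polynomial K) •
    ξ.map Polynomial.C)).det
  have hq : ∀ u, q.eval u = (krylov (h + u • ξ)).det := by
    intro u
    simp only [q]
    rw [← Polynomial.coe_evalRingHom, RingHom.map_det, map_krylov]
    congr 2
    ext i j
    simp [mul_comm u]
  have hq0 : q ≠ 0 := by
    intro h0
    apply hkr
    have := hq 0
    rw [h0, Polynomial.eval_zero, zero_smul, add_zero] at this
    exact this.symm
  -- The polynomial `q` controls `h + u ξ`, while semicontinuity at `ξ` needs `ξ + s h`. These are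
  -- proportional for `u = s⁻¹`, hence the inverted roots and the exclusion of `0`.
  obtain ⟨s, hs, hle⟩ := exists_finrank_ker_add_smul_le (commutatorForm c ξ) (commutatorForm c h)
    ((insert 0 q.roots.toFinset).image (·⁻¹))
  refine le_trans ?_ hle
  have hs0 : s ≠ 0 := by
    rintro rfl
    exact hs (Finset.mem_image.2 ⟨0, Finset.mem_insert_self _ _, inv_zero⟩)
  have hqs : (krylov (h + s⁻¹ • ξ)).det ≠ 0 := by
    rw [← hq]
    intro h0
    refine hs (Finset.mem_image.2 ⟨s⁻¹, Finset.mem_insert_of_mem ?_, inv_inv s⟩)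
    rw [Multiset.mem_toFinset, Polynomial.mem_roots hq0]
    exact h0
  refine (le_finrank_ker_commutatorForm_of_krylov h2 hc
    (add_mem hh (Submodule.smul_mem _ _ hξ)) hqs).trans ?_
  apply Submodule.finrank_mono
  intro x hx
  rw [LinearMap.mem_ker] at hx ⊢
  rw [commutatorForm_add_smul] at hx
  have : commutatorForm c ξ + s • commutatorForm c h =
      s • (commutatorForm c h + s⁻¹ • commutatorForm c ξ) := by
    rw [smul_add, smul_smul, mul_inv_cancel₀ hs0, one_smul, add_comm]
  rw [this, LinearMap.smul_apply, hx, smul_zero]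

/-- Writing `γ` as the trace form against some symplectic `y` makes every member of the pencil the
commutator form of `e + s y`, so Vinberg's inequality applies without exceptional `s`. -/
theorem le_finrank_centralKernel [IsAlgClosed K] (h2 : (2 : K) ≠ 0) {c : K} (hc : c = 1 ∨ c = -1)
    {e : Matrix (Fin n ⊕ Fin n) (Fin n ⊕ Fin n) K} (he : e ∈ adjointEigenspace (-1 : K))
    (γ : Dual K (Matrix (Fin n ⊕ Fin n) (Fin n ⊕ Fin n) K))
    (hγ : ∀ x ∈ adjointEigenspace (n := Fin n) (1 : K), γ x = 0) :
    n ≤ finrank K (centralKernel c e γ) := by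
  have hinf : Infinite K := IsAlgClosed.instInfinite
  have hcc : c * c = 1 := by rcases hc with rfl | rfl <;> norm_num
  obtain ⟨y, hy, hyγ⟩ := exists_trace_mul_eq h2 γ hγ
  have := le_finrank_ker_restrict (commutatorForm c e) (commutatorForm c y)
    (commutatorForm_skew c e) n ∅ (fun s _ => by
      rw [← commutatorForm_add_smul]
      exact le_finrank_ker_commutatorForm h2 hc (add_mem he (Submodule.smul_mem _ _ hy)))
    ((centralKernel c e γ).comap (adjointEigenspace c).subtype) (fun x => by
      rw [Submodule.mem_comap, mem_centralKernel, commutatorForm_eq_zero_iff h2 hcc he]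
      simp only [commutatorForm_eq_zero_iff h2 hcc he, commutatorForm_apply, hyγ]
      exact ⟨fun h => ⟨h.2.1, fun z hz => h.2.2 z.1 z.2 hz⟩,
        fun h => ⟨x.2, h.1, fun z hz hz' => h.2 ⟨z, hz⟩ hz'⟩⟩)
  refine this.trans ?_
  have hle : centralKernel c e γ ≤ adjointEigenspace c := fun x hx => (mem_centralKernel.1 hx).1
  rw [(Submodule.comapSubtypeEquivOfLe hle).finrank_eq]

end LowerBound

/-! ### Symplectic Jordan normal form of a nilpotent element. -/

section NormalForm

variable {K V : Type*} [Field K] [AddCommGroup V] [Module K V]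

/-- A normal form, on an invariant subspace `S`, of a nilpotent endomorphism `e` which is
skew-adjoint for an alternating form `ω`: the vectors `e ^ s (w i)` with `i < p` and `s ≤ d i` span
`S`, and the generators are paired by an involution `σ` moving indices by at most one. -/
structure SymplecticChains (ω : V →ₗ[K] V →ₗ[K] K) (e : End K V) (S : Submodule K V) where
  p : ℕ
  w : ℕ → V
  d : ℕ → ℕ
  σ : ℕ → ℕ
  ε : ℕ → K
  w_mem : ∀ i < p, w i ∈ S
  pow_eq_zero : ∀ i < p, (e ^ (d i + 1)) (w i) = 0
  anti : ∀ i j, i ≤ j → j < p → d j ≤ d i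
  σ_lt : ∀ i < p, σ i < p
  σ_σ : ∀ i < p, σ (σ i) = i
  d_σ : ∀ i < p, d (σ i) = d i
  σ_le : ∀ i < p, σ i ≤ i + 1
  le_σ : ∀ i < p, i ≤ σ i + 1
  ε_mul_self : ∀ i < p, ε i * ε i = 1
  ε_σ : ∀ i < p, σ i ≠ i → ε (σ i) = - ε i
  pair_self : ∀ i < p, ω (w (σ i)) ((e ^ d i) (w i)) = ε i
  pair_ne : ∀ i j s, i < p → j < p → i ≠ j → (d i ≤ s ∨ d j ≤ s) →
    ω (w (σ j)) ((e ^ s) (w i)) = 0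
  le_span : S ≤ Submodule.span K {v | ∃ i < p, ∃ s, v = (e ^ s) (w i)}

theorem pow_skew {ω : V →ₗ[K] V →ₗ[K] K} {e : End K V} (he : ∀ v w, ω (e v) w = - ω v (e w))
    (s : ℕ) (v w : V) : ω ((e ^ s) v) w = (-1) ^ s * ω v ((e ^ s) w) := by
  induction s generalizing v w with
  | zero => simp
  | succ s ih =>
    rw [pow_succ, Module.End.mul_apply, ih, he, pow_succ', ← Module.End.mul_apply, ← pow_succ',
      ← pow_succ]
    rw [pow_succ, Module.End.mul_apply]
    ring_nf

/-- The function given by `f` below `q` and by `g`, shifted by `q`, from `q` on. -/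
def glue {α : Type*} (q : ℕ) (f g : ℕ → α) (i : ℕ) : α := if i < q then f i else g (i - q)

theorem glue_of_lt {α : Type*} {q : ℕ} {f g : ℕ → α} {i : ℕ} (h : i < q) :
    glue q f g i = f i := if_pos h

@[simp]
theorem glue_add {α : Type*} {q : ℕ} {f g : ℕ → α} (k : ℕ) : glue q f g (q + k) = g k := by
  simp [glue]

/-- A family of generators of chains of equal length `d + 1` which is in normal form. -/
structure SymplecticBlock (ω : V →ₗ[K] V →ₗ[K] K) (e : End K V) (S : Submodule K V) (d : ℕ) where
  q : ℕ
  b : ℕ → V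
  τ : ℕ → ℕ
  η : ℕ → K
  q_pos : 0 < q
  b_mem : ∀ i < q, b i ∈ S
  τ_lt : ∀ i < q, τ i < q
  τ_τ : ∀ i < q, τ (τ i) = i
  τ_le : ∀ i < q, τ i ≤ i + 1
  le_τ : ∀ i < q, i ≤ τ i + 1
  η_mul_self : ∀ i < q, η i * η i = 1
  η_τ : ∀ i < q, τ i ≠ i → η (τ i) = - η i
  pair : ∀ i j, i < q → j < q → ω (b (τ j)) ((e ^ d) (b i)) = if i = j then η j else 0

namespace SymplecticBlock

variable {ω : V →ₗ[K] V →ₗ[K] K} {e : End K V} {S : Submodule K V} {d : ℕ}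

/-- The span of the chains of a block. -/
def chainSpan (B : SymplecticBlock ω e S d) : Submodule K V :=
  Submodule.span K {v | ∃ i < B.q, ∃ s, v = (e ^ s) (B.b i)}

/-- The orthogonal complement, in the ambient subspace, of the chains of a block. -/
def complement (B : SymplecticBlock ω e S d) : Submodule K V where
  carrier := {v | v ∈ S ∧ ∀ i < B.q, ∀ s, ω (B.b i) ((e ^ s) v) = 0}
  zero_mem' := by simp
  add_mem' := by
    rintro x y ⟨hx, hx'⟩ ⟨hy, hy'⟩
    refine ⟨add_mem hx hy, fun i hi s => ?_⟩
    rw [map_add, map_add, hx' i hi, hy' i hi, add_zero]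
  smul_mem' := by
    rintro c x ⟨hx, hx'⟩
    refine ⟨S.smul_mem c hx, fun i hi s => ?_⟩
    rw [map_smul, map_smul, hx' i hi, smul_zero]

variable (B : SymplecticBlock ω e S d)

theorem pow_mem (hS : ∀ v ∈ S, e v ∈ S) {v : V} (hv : v ∈ S) (s : ℕ) : (e ^ s) v ∈ S := by
  induction s with
  | zero => simpa
  | succ s ih =>
    rw [pow_succ', Module.End.mul_apply]
    exact hS _ ih

theorem pow_eq_zero_of_le (hd : ∀ v ∈ S, (e ^ (d + 1)) v = 0) {v : V} (hv : v ∈ S) {s : ℕ}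
    (hs : d + 1 ≤ s) : (e ^ s) v = 0 := by
  obtain ⟨k, rfl⟩ := Nat.exists_eq_add_of_le hs
  rw [add_comm, pow_add, Module.End.mul_apply, hd v hv, map_zero]

/-- Triangular elimination from high powers of `e` downwards. Adding combinations of `(e ^ m) (b j)`
corrects the pairing at `s = d - m` and leaves those at larger `s` unchanged, since `e ^ (d + 1)`
kills `S`. -/
theorem exists_sub_orthogonal (hd : ∀ v ∈ S, (e ^ (d + 1)) v = 0) {v : V} (hv : v ∈ S) (m : ℕ)
    (hm : m ≤ d + 1) : ∃ u ∈ B.chainSpan, ∀ i < B.q, ∀ s, d + 1 ≤ s + m →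
      ω (B.b i) ((e ^ s) (v - u)) = 0 := by
  induction m with
  | zero =>
    refine ⟨0, zero_mem _, fun i hi s hs => ?_⟩
    rw [sub_zero, pow_eq_zero_of_le hd hv (by omega), map_zero]
  | succ m ih =>
    obtain ⟨u, hu, h⟩ := ih (by omega)
    let c : ℕ → K := fun j => B.η j * ω (B.b (B.τ j)) ((e ^ (d - m)) (v - u))
    let u' := ∑ j ∈ Finset.range B.q, c j • (e ^ m) (B.b j)
    refine ⟨u + u', add_mem hu (Submodule.sum_mem _ fun j hj => Submodule.smul_mem _ _
      (Submodule.subset_span ⟨j, Finset.mem_range.1 hj, m, rfl⟩)), ?_⟩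
    intro i hi s hs
    have e1 : ∀ i, ω (B.b i) ((e ^ s) u') =
        ∑ j ∈ Finset.range B.q, c j * ω (B.b i) ((e ^ (s + m)) (B.b j)) := by
      intro i
      simp only [u', map_sum, map_smul, smul_eq_mul, pow_add, Module.End.mul_apply]
    rw [← sub_sub, map_sub, map_sub, e1]
    rcases (show s = d - m ∨ d + 1 ≤ s + m by omega) with rfl | hs'
    · rw [← B.τ_τ i hi, show d - m + m = d by omega]
      have hj := B.τ_lt i hi
      rw [Finset.sum_eq_single_of_mem (B.τ i) (Finset.mem_range.2 hj)]
      · rw [B.pair _ _ hj hj, if_pos rfl]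
        simp only [c]
        linear_combination (-ω (B.b (B.τ (B.τ i))) ((e ^ (d - m)) (v - u))) * B.η_mul_self _ hj
      · intro k hk hne
        rw [B.pair _ _ (Finset.mem_range.1 hk) hj, if_neg hne, mul_zero]
    · rw [h i hi s hs', Finset.sum_eq_zero, sub_zero]
      intro j hj
      rw [pow_eq_zero_of_le hd (B.b_mem j (Finset.mem_range.1 hj)) hs', map_zero, mul_zero]

theorem chainSpan_le (hS : ∀ v ∈ S, e v ∈ S) : B.chainSpan ≤ S := by
  rw [chainSpan, Submodule.span_le]
  rintro _ ⟨i, hi, s, rfl⟩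
  exact pow_mem hS (B.b_mem i hi) s

theorem exists_sub_mem_complement (hS : ∀ v ∈ S, e v ∈ S) (hd : ∀ v ∈ S, (e ^ (d + 1)) v = 0)
    {v : V} (hv : v ∈ S) : ∃ u ∈ B.chainSpan, v - u ∈ B.complement := by
  obtain ⟨u, hu, h⟩ := B.exists_sub_orthogonal hd hv (d + 1) le_rfl
  exact ⟨u, hu, sub_mem hv (B.chainSpan_le hS hu), fun i hi s => h i hi s (by omega)⟩

theorem complement_invariant (hS : ∀ v ∈ S, e v ∈ S) : ∀ v ∈ B.complement, e v ∈ B.complement := by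
  rintro v ⟨hv, hv'⟩
  refine ⟨hS v hv, fun i hi s => ?_⟩
  rw [← Module.End.mul_apply, ← pow_succ]
  exact hv' i hi _

theorem complement_lt : B.complement < S := by
  refine lt_of_le_of_ne (fun v hv => hv.1) fun h => ?_
  have h0 : B.b 0 ∈ B.complement := h.ge (B.b_mem 0 B.q_pos)
  have h1 := h0.2 (B.τ 0) (B.τ_lt 0 B.q_pos) d
  rw [B.pair 0 0 B.q_pos B.q_pos, if_pos rfl] at h1
  have h2 := B.η_mul_self 0 B.q_pos
  rw [h1, zero_mul] at h2
  exact zero_ne_one h2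

theorem orthogonal_chainSpan (he : ∀ v w, ω (e v) w = - ω v (e w)) {u v : V}
    (hu : u ∈ B.chainSpan) (hv : v ∈ B.complement) : ω u v = 0 := by
  rw [chainSpan] at hu
  induction hu using Submodule.span_induction with
  | mem x hx =>
    obtain ⟨i, hi, s, rfl⟩ := hx
    rw [pow_skew he, hv.2 i hi s, mul_zero]
  | zero => simp
  | add x y _ _ hx hy => rw [map_add, LinearMap.add_apply, hx, hy, add_zero]
  | smul c x _ hx => rw [map_smul, LinearMap.smul_apply, hx, smul_zero]

theorem complement_nondegenerate (hS : ∀ v ∈ S, e v ∈ S) (hd : ∀ v ∈ S, (e ^ (d + 1)) v = 0)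
    (he : ∀ v w, ω (e v) w = - ω v (e w)) (hω : ∀ v ∈ S, (∀ w ∈ S, ω w v = 0) → v = 0) :
    ∀ v ∈ B.complement, (∀ w ∈ B.complement, ω w v = 0) → v = 0 := by
  intro v hv h
  refine hω v hv.1 fun w hw => ?_
  obtain ⟨u, hu, huw⟩ := B.exists_sub_mem_complement hS hd hw
  rw [← sub_add_cancel w u, map_add, LinearMap.add_apply, h _ huw,
    B.orthogonal_chainSpan he hu hv, add_zero]

/-- Normal forms of a block and of its orthogonal complement combine to a normal form. -/
def append (hskew : ∀ v w, ω v w = - ω w v) (hS : ∀ v ∈ S, e v ∈ S)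
    (hd : ∀ v ∈ S, (e ^ (d + 1)) v = 0) (he : ∀ v w, ω (e v) w = - ω v (e w))
    (C : SymplecticChains ω e B.complement) : SymplecticChains ω e S where
  p := B.q + C.p
  w := glue B.q B.b C.w
  d := glue B.q (fun _ => d) C.d
  σ := glue B.q B.τ fun k => B.q + C.σ k
  ε := glue B.q B.η C.ε
  w_mem i hi := by
    rcases lt_or_ge i B.q with h | h
    · rw [glue_of_lt h]
      exact B.b_mem i h
    · obtain ⟨k, rfl⟩ := Nat.exists_eq_add_of_le h
      rw [glue_add]
      exact (C.w_mem k (by omega)).1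
  pow_eq_zero i hi := by
    rcases lt_or_ge i B.q with h | h
    · rw [glue_of_lt h, glue_of_lt h]
      exact hd _ (B.b_mem i h)
    · obtain ⟨k, rfl⟩ := Nat.exists_eq_add_of_le h
      rw [glue_add, glue_add]
      exact C.pow_eq_zero k (by omega)
  anti i j hij hj := by
    -- A longer chain in the complement would have `pair_self` zero, yet its value squares to one.
    have hle : ∀ k < C.p, C.d k ≤ d := by
      intro k hk
      by_contra! hlt
      have h1 := C.pair_self k hk
      rw [pow_eq_zero_of_le hd (C.w_mem k hk).1 hlt, map_zero] at h1
      have h2 := C.ε_mul_self k hk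
      rw [← h1, zero_mul] at h2
      exact zero_ne_one h2
    rcases lt_or_ge j B.q with h | h
    · rw [glue_of_lt h, glue_of_lt (lt_of_le_of_lt hij h)]
    · obtain ⟨k, rfl⟩ := Nat.exists_eq_add_of_le h
      rw [glue_add]
      rcases lt_or_ge i B.q with h' | h'
      · rw [glue_of_lt h']
        exact hle k (by omega)
      · obtain ⟨l, rfl⟩ := Nat.exists_eq_add_of_le h'
        rw [glue_add]
        exact C.anti l k (by omega) (by omega)
  σ_lt i hi := by
    rcases lt_or_ge i B.q with h | h
    · rw [glue_of_lt h]
      have := B.τ_lt i h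
      omega
    · obtain ⟨k, rfl⟩ := Nat.exists_eq_add_of_le h
      rw [glue_add]
      have := C.σ_lt k (by omega)
      omega
  σ_σ i hi := by
    rcases lt_or_ge i B.q with h | h
    · rw [glue_of_lt h, glue_of_lt (B.τ_lt i h), B.τ_τ i h]
    · obtain ⟨k, rfl⟩ := Nat.exists_eq_add_of_le h
      rw [glue_add, glue_add, C.σ_σ k (by omega)]
  d_σ i hi := by
    rcases lt_or_ge i B.q with h | h
    · rw [glue_of_lt (i := i) h, glue_of_lt (B.τ_lt i h), glue_of_lt h]
    · obtain ⟨k, rfl⟩ := Nat.exists_eq_add_of_le h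
      rw [glue_add, glue_add, glue_add, C.d_σ k (by omega)]
  σ_le i hi := by
    rcases lt_or_ge i B.q with h | h
    · rw [glue_of_lt h]
      exact B.τ_le i h
    · obtain ⟨k, rfl⟩ := Nat.exists_eq_add_of_le h
      rw [glue_add]
      have := C.σ_le k (by omega)
      omega
  le_σ i hi := by
    rcases lt_or_ge i B.q with h | h
    · rw [glue_of_lt h]
      exact B.le_τ i h
    · obtain ⟨k, rfl⟩ := Nat.exists_eq_add_of_le h
      rw [glue_add]
      have := C.le_σ k (by omega)
      omega
  ε_mul_self i hi := by
    rcases lt_or_ge i B.q with h | h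
    · rw [glue_of_lt h]
      exact B.η_mul_self i h
    · obtain ⟨k, rfl⟩ := Nat.exists_eq_add_of_le h
      rw [glue_add]
      exact C.ε_mul_self k (by omega)
  ε_σ i hi hne := by
    rcases lt_or_ge i B.q with h | h
    · rw [glue_of_lt (i := i) h] at hne ⊢
      rw [glue_of_lt (B.τ_lt i h), glue_of_lt h]
      exact B.η_τ i h hne
    · obtain ⟨k, rfl⟩ := Nat.exists_eq_add_of_le h
      rw [glue_add] at hne ⊢
      rw [glue_add, glue_add]
      exact C.ε_σ k (by omega) (by omega)
  pair_self i hi := by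
    rcases lt_or_ge i B.q with h | h
    · rw [glue_of_lt (i := i) h, glue_of_lt (B.τ_lt i h), glue_of_lt h, glue_of_lt h, glue_of_lt h,
        B.pair i i h h, if_pos rfl]
    · obtain ⟨k, rfl⟩ := Nat.exists_eq_add_of_le h
      rw [glue_add, glue_add, glue_add, glue_add, glue_add]
      exact C.pair_self k (by omega)
  pair_ne i j s hi hj hne hs := by
    rcases lt_or_ge i B.q with h | h <;> rcases lt_or_ge j B.q with h' | h'
    · rw [glue_of_lt h, glue_of_lt h', or_self] at hs
      rw [glue_of_lt h', glue_of_lt (B.τ_lt j h'), glue_of_lt h]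
      rcases hs.eq_or_lt with rfl | hs
      · rw [B.pair i j h h', if_neg hne]
      · rw [pow_eq_zero_of_le hd (B.b_mem i h) hs, map_zero]
    · obtain ⟨k, rfl⟩ := Nat.exists_eq_add_of_le h'
      rw [glue_add, glue_add, glue_of_lt h, hskew, B.orthogonal_chainSpan he
        (Submodule.subset_span ⟨i, h, s, rfl⟩) (C.w_mem _ (C.σ_lt k (by omega))), neg_zero]
    · obtain ⟨k, rfl⟩ := Nat.exists_eq_add_of_le h
      rw [glue_add, glue_of_lt h', glue_of_lt (B.τ_lt j h')]
      exact (C.w_mem k (by omega)).2 _ (B.τ_lt j h') s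
    · obtain ⟨k, rfl⟩ := Nat.exists_eq_add_of_le h
      obtain ⟨l, rfl⟩ := Nat.exists_eq_add_of_le h'
      rw [glue_add, glue_add] at hs
      rw [glue_add, glue_add, glue_add]
      exact C.pair_ne k l s (by omega) (by omega) (by omega) hs
  le_span := by
    intro v hv
    obtain ⟨u, hu, huv⟩ := B.exists_sub_mem_complement hS hd hv
    rw [← sub_add_cancel v u]
    refine add_mem (Submodule.span_mono ?_ (C.le_span huv)) (Submodule.span_mono ?_ hu)
    · rintro _ ⟨k, hk, s, rfl⟩
      exact ⟨B.q + k, by omega, s, by rw [glue_add]⟩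
    · rintro _ ⟨i, hi, s, rfl⟩
      exact ⟨i, by omega, s, by rw [glue_of_lt hi]⟩

end SymplecticBlock

/-- The form `ω w ((e ^ d) v)` is alternating for even `d` and symmetric for odd `d`. The first case
gives a hyperbolic pair exchanged by `τ`; the second a nonisotropic vector, by polarisation,
normalised with a square root. -/
theorem nonempty_symplecticBlock [IsAlgClosed K] (h2 : (2 : K) ≠ 0)
    {ω : V →ₗ[K] V →ₗ[K] K} {e : End K V} {S : Submodule K V} {d : ℕ}
    (hskew : ∀ v w, ω v w = - ω w v) (he : ∀ v w, ω (e v) w = - ω v (e w))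
    {v w : V} (hv : v ∈ S) (hw : w ∈ S) (hvw : ω w ((e ^ d) v) ≠ 0) :
    Nonempty (SymplecticBlock ω e S d) := by
  have hswap : ∀ v w, ω w ((e ^ d) v) = - (-1) ^ d * ω v ((e ^ d) w) := by
    intro v w
    rw [hskew, pow_skew he, neg_mul]
  rcases Nat.even_or_odd d with hd | hd
  · simp only [hd.neg_one_pow, neg_one_mul] at hswap
    have hself : ∀ v, ω v ((e ^ d) v) = 0 := by
      intro v
      have : 2 * ω v ((e ^ d) v) = 0 := by linear_combination hswap v v
      exact (mul_eq_zero.1 this).resolve_left h2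
    let w' := (ω w ((e ^ d) v))⁻¹ • w
    have h1 : ω w' ((e ^ d) v) = 1 := by
      simp only [w', map_smul, LinearMap.smul_apply, smul_eq_mul]
      exact inv_mul_cancel₀ hvw
    have h2 : ω v ((e ^ d) w') = -1 := by rw [hswap, h1]
    refine ⟨{ q := 2, b := fun i => if i = 0 then v else w', τ := fun i => 1 - i,
              η := fun i => if i = 0 then 1 else -1, q_pos := two_pos, b_mem := ?_, τ_lt := ?_,
              τ_τ := ?_, τ_le := ?_, le_τ := ?_, η_mul_self := ?_, η_τ := ?_, pair := ?_ }⟩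
    · intro i _
      split_ifs
      · exact hv
      · exact S.smul_mem _ hw
    · intro i hi; omega
    · intro i hi; omega
    · intro i hi; omega
    · intro i hi; omega
    · intro i _; split_ifs <;> norm_num
    · intro i hi _
      interval_cases i <;> simp
    · intro i j hi hj
      interval_cases i <;> interval_cases j <;> simp [h1, h2, hself]
  · simp only [hd.neg_one_pow, neg_neg, one_mul] at hswap
    obtain ⟨u, hu, huu⟩ : ∃ u ∈ S, ω u ((e ^ d) u) ≠ 0 := by
      by_contra! h
      have h1 := h (v + w) (add_mem hv hw)
      simp only [map_add, LinearMap.add_apply] at h1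
      rw [h v hv, h w hw, hswap w v] at h1
      have : 2 * ω w ((e ^ d) v) = 0 := by linear_combination h1
      exact hvw ((mul_eq_zero.1 this).resolve_left h2)
    obtain ⟨c, hc⟩ := IsAlgClosed.exists_pow_nat_eq (ω u ((e ^ d) u))⁻¹ (n := 2) two_pos
    refine ⟨{ q := 1, b := fun _ => c • u, τ := fun i => i, η := fun _ => 1, q_pos := one_pos,
              b_mem := fun _ _ => S.smul_mem _ hu, τ_lt := fun _ h => h, τ_τ := fun _ _ => rfl,
              τ_le := fun i _ => Nat.le_succ i, le_τ := fun i _ => Nat.le_succ i,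
              η_mul_self := fun _ _ => one_mul 1, η_τ := fun _ _ h => (h rfl).elim, pair := ?_ }⟩
    intro i j hi hj
    rw [if_pos (by omega)]
    simp only [map_smul, LinearMap.smul_apply, smul_eq_mul]
    rw [← mul_assoc, ← pow_two, hc, inv_mul_cancel₀ huu]

/-- Induction on `S`: split off a block of chains of maximal length and continue in its orthogonal
complement, which is smaller, invariant and again nondegenerate. Taking the longest chains first
makes `d` decreasing. -/
theorem nonempty_symplecticChains_of_invariant [IsAlgClosed K] [FiniteDimensional K V]
    (h2 : (2 : K) ≠ 0) {ω : V →ₗ[K] V →ₗ[K] K} {e : End K V} (hnil : IsNilpotent e)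
    (hskew : ∀ v w, ω v w = - ω w v) (he : ∀ v w, ω (e v) w = - ω v (e w)) (S : Submodule K V)
    (hS : ∀ v ∈ S, e v ∈ S) (hω : ∀ v ∈ S, (∀ w ∈ S, ω w v = 0) → v = 0) :
    Nonempty (SymplecticChains ω e S) := by
  classical
  induction S using WellFoundedLT.induction with
  | ind S ih =>
    by_cases hbot : S = ⊥
    · exact ⟨{ p := 0, w := 0, d := 0, σ := 0, ε := 0
               w_mem := by simp
               pow_eq_zero := by simp
               anti := by simp
               σ_lt := by simp
               σ_σ := by simp
               d_σ := by simp
               σ_le := by simp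
               le_σ := by simp
               ε_mul_self := by simp
               ε_σ := by simp
               pair_self := by simp
               pair_ne := by simp
               le_span := by simp [hbot] }⟩
    · have hex : ∃ k, ∀ v ∈ S, (e ^ k) v = 0 := by
        obtain ⟨k, hk⟩ := hnil
        exact ⟨k, fun v _ => by rw [hk, LinearMap.zero_apply]⟩
      obtain ⟨d, hd⟩ : ∃ d, Nat.find hex = d + 1 := by
        refine Nat.exists_eq_succ_of_ne_zero fun h0 => hbot ?_
        rw [eq_bot_iff]
        intro v hv
        have := Nat.find_spec hex v hv
        rw [h0] at this
        simpa using this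
      have hd' : ∀ v ∈ S, (e ^ (d + 1)) v = 0 := hd ▸ Nat.find_spec hex
      have hmin := Nat.find_min hex (m := d) (by omega)
      push Not at hmin
      obtain ⟨v, hv, hne⟩ := hmin
      obtain ⟨w, hw, hvw⟩ : ∃ w ∈ S, ω w ((e ^ d) v) ≠ 0 := by
        by_contra! h
        exact hne (hω _ (SymplecticBlock.pow_mem hS hv d) h)
      obtain ⟨B⟩ := nonempty_symplecticBlock h2 hskew he hv hw hvw
      obtain ⟨C⟩ := ih B.complement B.complement_lt (B.complement_invariant hS)
        (B.complement_nondegenerate hS hd' he hω)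
      exact ⟨B.append hskew hS hd' he C⟩

end NormalForm

/-! ### Truncated Sylvester equations with only the zero solution. -/

section Sylvester

variable {K : Type*} [Field K] {p : ℕ} {d : ℕ → ℕ} {ε : ℕ → K} {c F : ℕ → ℕ → K}

/-- Induction over diagonals from the lower left corner. Once the lower diagonals vanish, the
equation at `(k, l + 1)` involves only the neighbours `F l k` and `F (l + 1) (k + 1)`. Monotonicity
of `d` guarantees that the needed side survives truncation. -/
theorem eq_zero_of_hessenberg (hd : ∀ i j, i ≤ j → j < p → d j ≤ d i)
    (hε : ∀ i < p, ε i ≠ 0)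
    (hc : ∀ k j, k < p → j < p → k + 1 < j → c k j = 0)
    (hc' : ∀ k, k + 1 < p → c k (k + 1) ≠ 0)
    (hR : ∀ k l, k < p → l < p →
      (if d l ≤ d k then ε k * ∑ j ∈ Finset.range p, c k j * F l j else 0) =
      if d k ≤ d l then (∑ i ∈ Finset.range p, F i k * c i l) * ε l else 0)
    (h0 : ∀ l < p, F l 0 = 0) : ∀ i < p, ∀ j < p, F i j = 0 := by
  -- `D` is `j - i + p`; the shift keeps it a natural number.
  have main : ∀ D i j, i < p → j < p → j + p = i + D → F i j = 0 := by
    intro D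
    induction D using Nat.strong_induction_on with
    | _ D ih =>
      have ih' : ∀ i j, i < p → j < p → j + p < i + D → F i j = 0 := fun i j hi hj h =>
        ih (j + p - i) (by omega) i j hi hj (by omega)
      have hL : ∀ k l, k < p → l < p → k + 1 + p = l + D →
          ∑ j ∈ Finset.range p, c k j * F l j =
            if k + 1 < p then c k (k + 1) * F l (k + 1) else 0 := by
        intro k l hk hl hkl
        have hz : ∀ j ∈ Finset.range p, j ≠ k + 1 → c k j * F l j = 0 := by
          intro j hj hne
          rw [Finset.mem_range] at hj
          rcases lt_or_ge (k + 1) j with h | h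
          · rw [hc k j hk hj h, zero_mul]
          · rw [ih' l j hl hj (by omega), mul_zero]
        split_ifs with h
        · exact Finset.sum_eq_single_of_mem _ (Finset.mem_range.2 h) hz
        · exact Finset.sum_eq_zero fun j hj => hz j hj (by
            rw [Finset.mem_range] at hj
            omega)
      have hRs : ∀ k l, k < p → l + 1 < p → k + p = l + D →
          ∑ i ∈ Finset.range p, F i k * c i (l + 1) = F l k * c l (l + 1) := by
        intro k l hk hl hkl
        refine Finset.sum_eq_single_of_mem _ (Finset.mem_range.2 (by omega)) fun i hi hne => ?_
        rw [Finset.mem_range] at hi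
        rcases lt_or_ge i l with h | h
        · rw [hc i (l + 1) hi hl (by omega), mul_zero]
        · rw [ih' i k hi hk (by omega), zero_mul]
      -- Above the main diagonal the right side is present, so vanishing propagates upwards from the
      -- last column, where `F (i + 1) (j + 1)` is absent.
      have upper : ∀ t i j, j + t + 1 = p → i < j → j + p = i + D → F i j = 0 := by
        intro t
        induction t with
        | zero =>
          intro i j hj hij hD
          have := hR j (i + 1) (by omega) (by omega)
          rw [hL j (i + 1) (by omega) (by omega) (by omega), if_neg (by omega : ¬ j + 1 < p),
            mul_zero, ite_self, if_pos (hd _ _ (by omega) (by omega)),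
            hRs j i (by omega) (by omega) hD] at this
          have h1 := hc' i (by omega)
          have h2 := hε (i + 1) (by omega)
          simpa [h1, h2] using this.symm
        | succ t iht =>
          intro i j hj hij hD
          have := hR j (i + 1) (by omega) (by omega)
          rw [hL j (i + 1) (by omega) (by omega) (by omega), if_pos (by omega : j + 1 < p),
            iht (i + 1) (j + 1) (by omega) (by omega) (by omega), mul_zero, mul_zero, ite_self,
            if_pos (hd _ _ (by omega) (by omega)), hRs j i (by omega) (by omega) hD] at this
          have h1 := hc' i (by omega)
          have h2 := hε (i + 1) (by omega)
          simpa [h1, h2] using this.symm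
      -- On and below the main diagonal the left side is present, so vanishing propagates downwards
      -- from column `0`.
      have lower : ∀ j i, i < p → j ≤ i → j + p = i + D → F i j = 0 := by
        intro j
        induction j with
        | zero => exact fun i hi _ _ => h0 i hi
        | succ j ihj =>
          intro i hi hij hD
          obtain ⟨i, rfl⟩ : ∃ i', i = i' + 1 := ⟨i - 1, by omega⟩
          have := hR j (i + 1) (by omega) hi
          rw [if_pos (hd j (i + 1) (by omega) (by omega)),
            hL j (i + 1) (by omega) hi (by omega), if_pos (by omega),
            hRs j i (by omega) hi (by omega),
            ihj i (by omega) (by omega) (by omega), zero_mul, zero_mul, ite_self] at this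
          have h1 := hc' j (by omega)
          have h2 := hε j (by omega)
          simpa [h1, h2] using this
      intro i j hi hj hD
      rcases lt_or_ge i j with h | h
      · exact upper (p - j - 1) i j (by omega) h hD
      · exact lower j i hi h hD
  intro i hi j hj
  exact main (j + p - i) i j hi hj (by omega)

/-- Off the diagonal an entry is multiplied by one nonzero coefficient, or, when the lengths agree,
by the nonzero difference `ε k * m k - ε l * m l`. So `F` is diagonal and its row sums are its
entries. -/
theorem eq_zero_of_diagonal {m : ℕ → K} (hε : ∀ i < p, ε i * ε i = 1)
    (hc : ∀ k j, k < p → j < p → c k j = if k = j then m k else 0)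
    (hm : ∀ k < p, m k ≠ 0)
    (hm' : ∀ k l, k < p → l < p → ε k * m k = ε l * m l → k = l)
    (hR : ∀ k l, k < p → l < p →
      (if d l ≤ d k then ε k * ∑ j ∈ Finset.range p, c k j * F l j else 0) =
      if d k ≤ d l then (∑ i ∈ Finset.range p, F i k * c i l) * ε l else 0)
    (h0 : ∀ l < p, ∑ j ∈ Finset.range p, F l j = 0) : ∀ i < p, ∀ j < p, F i j = 0 := by
  have hε0 : ∀ i < p, ε i ≠ 0 := fun i hi h => by
    have := hε i hi
    rw [h, zero_mul] at this
    exact zero_ne_one this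
  have off : ∀ k l, k < p → l < p → k ≠ l → F l k = 0 := by
    intro k l hk hl hne
    have e1 : ∑ j ∈ Finset.range p, c k j * F l j = m k * F l k := by
      rw [Finset.sum_eq_single_of_mem k (Finset.mem_range.2 hk), hc k k hk hk, if_pos rfl]
      intro j hj hjk
      rw [hc k j hk (Finset.mem_range.1 hj), if_neg hjk.symm, zero_mul]
    have e2 : ∑ i ∈ Finset.range p, F i k * c i l = F l k * m l := by
      rw [Finset.sum_eq_single_of_mem l (Finset.mem_range.2 hl), hc l l hl hl, if_pos rfl]
      intro j hj hjl
      rw [hc j l (Finset.mem_range.1 hj) hl, if_neg hjl, mul_zero]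
    have h := hR k l hk hl
    rw [e1, e2] at h
    rcases lt_trichotomy (d l) (d k) with hlt | heq | hgt
    · rw [if_pos hlt.le, if_neg (not_le.2 hlt)] at h
      simpa [hε0 k hk, hm k hk] using h
    · rw [if_pos heq.le, if_pos heq.ge] at h
      have h1 : (ε k * m k - ε l * m l) * F l k = 0 := by linear_combination h
      exact (mul_eq_zero.1 h1).resolve_left
        (sub_ne_zero.2 fun h2 => hne (hm' k l hk hl h2))
    · rw [if_neg (not_le.2 hgt), if_pos hgt.le] at h
      simpa [hε0 l hl, hm l hl] using h.symm
  intro i hi j hj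
  by_cases hij : j = i
  · subst hij
    rw [← h0 j hj]
    exact (Finset.sum_eq_single_of_mem j (Finset.mem_range.2 hj) fun k hk hne =>
      off k j (Finset.mem_range.1 hk) hj hne).symm
  · exact off j i hj hi hij

end Sylvester

/-! ### Upper bound for kernels on the commutant, and the plane. -/

section UpperBound

variable {K V : Type*} [Field K] [AddCommGroup V] [Module K V]

/-- The kernel of the form `γ (x * y - y * x)` on the commutant of an endomorphism. -/
def commutantKernel (e : End K V) (γ : Dual K (End K V)) : Submodule K (End K V) where
  carrier := {x | e * x = x * e ∧ ∀ y, e * y = y * e → γ (x * y - y * x) = 0}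
  zero_mem' := by simp
  add_mem' := by
    rintro x y ⟨hx, hx'⟩ ⟨hy, hy'⟩
    refine ⟨by rw [mul_add, add_mul, hx, hy], fun z hz => ?_⟩
    rw [add_mul, mul_add, add_sub_add_comm, map_add, hx' z hz, hy' z hz, add_zero]
  smul_mem' := by
    rintro a x ⟨hx, hx'⟩
    refine ⟨by rw [mul_smul_comm, smul_mul_assoc, hx], fun z hz => ?_⟩
    rw [smul_mul_assoc, mul_smul_comm, ← smul_sub, map_smul, hx' z hz, smul_zero]

/-- The map `x ↦ Φ ∘ x` is injective. A nonzero `x` in its kernel could be replaced by the last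
nonzero `e ^ k * x`, which remains in the commutant kernel, is annihilated by `e` and by `Φ`, and so
is zero by hypothesis. -/
theorem finrank_commutantKernel_le [FiniteDimensional K V] {e : End K V} (he : IsNilpotent e)
    {γ : Dual K (End K V)} (Φ : Dual K V)
    (h : ∀ x ∈ commutantKernel e γ, e * x = 0 → (∀ v, Φ (x v) = 0) → x = 0) :
    finrank K (commutantKernel e γ) ≤ finrank K V := by
  classical
  rw [← Subspace.dual_finrank_eq (K := K) (V := V)]
  refine LinearMap.finrank_le_finrank_of_injective
    (f := (LinearMap.compRight K Φ : End K V →ₗ[K] Dual K V) ∘ₗ (commutantKernel e γ).subtype) ?_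
  rw [injective_iff_map_eq_zero]
  rintro ⟨x, hx⟩ hΦ
  have hΦ' : ∀ v, Φ (x v) = 0 := fun v => congrArg (fun φ : Dual K V => φ v) hΦ
  by_contra hne
  have hx0 : x ≠ 0 := fun h0 => hne (Subtype.ext h0)
  have hex : ∃ k, e ^ k * x = 0 := by
    obtain ⟨k, hk⟩ := he
    exact ⟨k, by rw [hk, zero_mul]⟩
  obtain ⟨k, hk⟩ : ∃ k, Nat.find hex = k + 1 := by
    refine Nat.exists_eq_succ_of_ne_zero fun h0 => hx0 ?_
    have := Nat.find_spec hex
    rwa [h0, pow_zero, one_mul] at this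
  have hmin : e ^ k * x ≠ 0 := Nat.find_min hex (by omega)
  have hspec : e ^ (k + 1) * x = 0 := hk ▸ Nat.find_spec hex
  have hcomm : e ^ k * x = x * e ^ k := (Commute.pow_left (show Commute e x from hx.1) k).eq
  refine hmin (h _ ⟨?_, fun y hy => ?_⟩ ?_ fun v => ?_)
  · rw [← mul_assoc, ← pow_succ', pow_succ, mul_assoc, mul_assoc, hx.1]
  · have hy' : e ^ k * y = y * e ^ k := (Commute.pow_left (show Commute e y from hy) k).eq
    rw [hcomm, mul_assoc, ← hcomm, ← mul_assoc y, ← hy']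
    refine hx.2 _ ?_
    rw [← mul_assoc, ← pow_succ', pow_succ, mul_assoc, mul_assoc, hy]
  · rw [← mul_assoc, ← pow_succ', hspec]
  · rw [hcomm]
    exact hΦ' _

/-- An operator commuting with `e`, built from two vectors killed by `e ^ (N + 1)`. -/
def chainOperator (ω : V →ₗ[K] V →ₗ[K] K) (e : End K V) (N : ℕ) (a b : V) : End K V :=
  ∑ s ∈ Finset.range (N + 1), (ω a ∘ₗ (e ^ (N - s))).smulRight ((e ^ s) b)

theorem chainOperator_apply (ω : V →ₗ[K] V →ₗ[K] K) (e : End K V) (N : ℕ) (a b v : V) :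
    chainOperator ω e N a b v =
      ∑ s ∈ Finset.range (N + 1), ω a ((e ^ (N - s)) v) • (e ^ s) b := by
  simp [chainOperator, LinearMap.sum_apply]

/-- The two sums agree after a shift of the index; the extra end terms vanish because `e ^ (N + 1)`
kills `b` and, by skewness, `a`. -/
theorem mul_chainOperator {ω : V →ₗ[K] V →ₗ[K] K} {e : End K V}
    (he : ∀ v w, ω (e v) w = - ω v (e w)) {N : ℕ} {a b : V}
    (ha : (e ^ (N + 1)) a = 0) (hb : (e ^ (N + 1)) b = 0) :
    e * chainOperator ω e N a b = chainOperator ω e N a b * e := by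
  ext v
  rw [Module.End.mul_apply, Module.End.mul_apply, chainOperator_apply, chainOperator_apply, map_sum,
    Finset.sum_range_succ, Finset.sum_range_succ']
  have h1 : e (ω a ((e ^ (N - N)) v) • (e ^ N) b) = 0 := by
    rw [map_smul, ← Module.End.mul_apply, ← pow_succ', hb, smul_zero]
  have h2 : ω a ((e ^ (N - 0)) (e v)) = 0 := by
    rw [← Module.End.mul_apply, ← pow_succ, Nat.sub_zero]
    have := pow_skew he (N + 1) a v
    rw [ha, map_zero, LinearMap.zero_apply] at this
    have h3 : (-1 : K) ^ (N + 1) ≠ 0 := pow_ne_zero _ (neg_ne_zero.2 one_ne_zero)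
    exact (mul_eq_zero.1 this.symm).resolve_left h3
  rw [h1, h2, zero_smul]
  congr 1
  refine Finset.sum_congr rfl fun s hs => ?_
  rw [Finset.mem_range] at hs
  rw [map_smul, ← Module.End.mul_apply, ← pow_succ', ← Module.End.mul_apply (e ^ (N - (s + 1))),
    ← pow_succ, show N - (s + 1) + 1 = N - s by omega]

namespace SymplecticChains

variable {ω : V →ₗ[K] V →ₗ[K] K} {e : End K V} (C : SymplecticChains ω e ⊤)

/-- The linear function on endomorphisms given by a matrix of coefficients on the generators. -/
def tensorForm (D : ℕ → ℕ → K) : Dual K (End K V) :=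
  ∑ i ∈ Finset.range C.p, ∑ m ∈ Finset.range C.p,
    D i m • ((ω (C.w m)) ∘ₗ (LinearMap.applyₗ (C.w i) : End K V →ₗ[K] V))

theorem tensorForm_apply (D : ℕ → ℕ → K) (x : End K V) : C.tensorForm D x =
    ∑ i ∈ Finset.range C.p, ∑ m ∈ Finset.range C.p, D i m * ω (C.w m) (x (C.w i)) := by
  simp [tensorForm, LinearMap.sum_apply]

theorem sum_range_σ (f : ℕ → K) :
    ∑ m ∈ Finset.range C.p, f m = ∑ j ∈ Finset.range C.p, f (C.σ j) := by
  refine Finset.sum_nbij' C.σ C.σ ?_ ?_ ?_ ?_ ?_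
  · exact fun i hi => Finset.mem_range.2 (C.σ_lt i (Finset.mem_range.1 hi))
  · exact fun i hi => Finset.mem_range.2 (C.σ_lt i (Finset.mem_range.1 hi))
  · exact fun i hi => C.σ_σ i (Finset.mem_range.1 hi)
  · exact fun i hi => C.σ_σ i (Finset.mem_range.1 hi)
  · exact fun i hi => by rw [C.σ_σ i (Finset.mem_range.1 hi)]

theorem tensorForm_eq_zero (h2 : (2 : K) ≠ 0) (hskew : ∀ v w, ω v w = - ω w v) {D : ℕ → ℕ → K}
    (hD : ∀ i m, i < C.p → m < C.p → D i m = D m i) {x : End K V}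
    (hx : ∀ v w, ω (x v) w = ω v (x w)) : C.tensorForm D x = 0 := by
  have h : C.tensorForm D x = - C.tensorForm D x := by
    conv_rhs => rw [tensorForm_apply, Finset.sum_comm]
    rw [tensorForm_apply, ← Finset.sum_neg_distrib]
    refine Finset.sum_congr rfl fun i hi => ?_
    rw [← Finset.sum_neg_distrib]
    refine Finset.sum_congr rfl fun m hm => ?_
    rw [hD i m (Finset.mem_range.1 hi) (Finset.mem_range.1 hm), hskew, hx, mul_neg]
  have h3 : 2 * C.tensorForm D x = 0 := by linear_combination h
  exact (mul_eq_zero.1 h3).resolve_left h2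

theorem eq_zero_of_forall_pair_eq_zero (hω : ∀ v, (∀ w, ω w v = 0) → v = 0)
    (he : ∀ v w, ω (e v) w = - ω v (e w)) {v : V} (hv : e v = 0)
    (h : ∀ j < C.p, ω (C.w (C.σ j)) v = 0) : v = 0 := by
  refine hω v fun u => ?_
  have hu := C.le_span (Submodule.mem_top (x := u))
  induction hu using Submodule.span_induction with
  | mem x hx =>
    obtain ⟨i, hi, s, rfl⟩ := hx
    rw [pow_skew he]
    rcases Nat.eq_zero_or_pos s with rfl | hs
    · have := h (C.σ i) (C.σ_lt i hi)
      rw [C.σ_σ i hi] at this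
      simp [this]
    · obtain ⟨t, rfl⟩ := Nat.exists_eq_succ_of_ne_zero hs.ne'
      rw [pow_succ e, Module.End.mul_apply, hv, map_zero, map_zero, mul_zero]
  | zero => simp
  | add x y _ _ hx hy => rw [map_add, LinearMap.add_apply, hx, hy, add_zero]
  | smul c x _ hx => rw [map_smul, LinearMap.smul_apply, hx, smul_zero]

theorem pair_top (j k : ℕ) (hj : j < C.p) (hk : k < C.p) :
    ω (C.w (C.σ j)) ((e ^ C.d k) (C.w k)) = if k = j then C.ε j else 0 := by
  split_ifs with h
  · subst h
    exact C.pair_self k hk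
  · exact C.pair_ne k j _ hk hj h (Or.inl le_rfl)

theorem pow_w_eq_zero {k s : ℕ} (hk : k < C.p) (hs : C.d k < s) : (e ^ s) (C.w k) = 0 := by
  obtain ⟨t, rfl⟩ := Nat.exists_eq_add_of_le hs
  rw [add_comm, pow_add, Module.End.mul_apply, Nat.succ_eq_add_one, C.pow_eq_zero k hk, map_zero]

/-- Expansion of the vectors killed by `e`. -/
theorem eq_sum_of_apply_eq_zero (hω : ∀ v, (∀ w, ω w v = 0) → v = 0)
    (he : ∀ v w, ω (e v) w = - ω v (e w)) {v : V} (hv : e v = 0) :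
    v = ∑ j ∈ Finset.range C.p, (C.ε j * ω (C.w (C.σ j)) v) • (e ^ C.d j) (C.w j) := by
  rw [← sub_eq_zero]
  refine C.eq_zero_of_forall_pair_eq_zero hω he ?_ fun j hj => ?_
  · rw [map_sub, hv, map_sum, Finset.sum_eq_zero, sub_zero]
    intro j hj
    rw [map_smul, ← Module.End.mul_apply, ← pow_succ', C.pow_eq_zero j (Finset.mem_range.1 hj),
      smul_zero]
  · rw [map_sub, map_sum, Finset.sum_eq_single_of_mem j (Finset.mem_range.2 hj)]
    · rw [map_smul, C.pair_self j hj, smul_eq_mul]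
      linear_combination (-ω (C.w (C.σ j)) v) * C.ε_mul_self j hj
    · intro k hk hne
      rw [map_smul, C.pair_top j k hj (Finset.mem_range.1 hk), if_neg hne, smul_zero]

/-- Such an `x` is determined by its values on generators; these lie in the kernel of `e`, where
pairing with the generators detects zero. -/
theorem eq_zero_of_pair_eq_zero (hω : ∀ v, (∀ w, ω w v = 0) → v = 0)
    (he : ∀ v w, ω (e v) w = - ω v (e w)) {x : End K V} (hex : e * x = 0) (hxe : e * x = x * e)
    (h : ∀ l < C.p, ∀ j < C.p, ω (C.w (C.σ j)) (x (C.w l)) = 0) : x = 0 := by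
  ext u
  have hu := C.le_span (Submodule.mem_top (x := u))
  induction hu using Submodule.span_induction with
  | mem y hy =>
    obtain ⟨i, hi, s, rfl⟩ := hy
    have hc : x * e ^ s = e ^ s * x := ((Commute.pow_left (show Commute e x from hxe) s).eq).symm
    rw [← Module.End.mul_apply, hc, Module.End.mul_apply, C.eq_zero_of_forall_pair_eq_zero hω he
      (v := x (C.w i)) (by rw [← Module.End.mul_apply, hex, LinearMap.zero_apply]) (h i hi),
      map_zero, LinearMap.zero_apply]
  | zero => simp
  | add x y _ _ hx hy => rw [map_add, map_add, hx, hy]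
  | smul c x _ hx => rw [map_smul, map_smul, hx]

/-- The Sylvester type equation for the matrix of an element, killed by `e`, of the kernel of the
form defined by `tensorForm D`. -/
theorem sylvester_equation (hω : ∀ v, (∀ w, ω w v = 0) → v = 0)
    (he : ∀ v w, ω (e v) w = - ω v (e w)) {D : ℕ → ℕ → K} {x : End K V}
    (hx : x ∈ commutantKernel e (C.tensorForm D)) (hex : e * x = 0) (k l : ℕ)
    (hk : k < C.p) (hl : l < C.p) :
    (if C.d l ≤ C.d k then C.ε k * ∑ j ∈ Finset.range C.p,
      D k (C.σ j) * ω (C.w (C.σ j)) (x (C.w l)) else 0) =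
    if C.d k ≤ C.d l then (∑ i ∈ Finset.range C.p,
      ω (C.w (C.σ k)) (x (C.w i)) * D i (C.σ l)) * C.ε l else 0 := by
  -- Test elements of the commutant. With truncated subtraction, `b` is `w l` if the chain of `l` is
  -- not longer than that of `k`, and otherwise the power of `e` on `w l` that `e ^ (C.d k)` moves
  -- to the end of its chain. This is where both truncations come from.
  set b := (e ^ (C.d l - C.d k)) (C.w l) with hb
  set y := chainOperator ω e (C.d k) (C.w (C.σ k)) b with hy
  have hex' : ∀ v, e (x v) = 0 := fun v => by
    rw [← Module.End.mul_apply, hex, LinearMap.zero_apply]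
  have hxe' : ∀ v, x (e v) = 0 := fun v => by
    rw [← Module.End.mul_apply, ← hx.1, hex, LinearMap.zero_apply]
  have hxpow : ∀ s v, 0 < s → x ((e ^ s) v) = 0 := by
    intro s v hs
    obtain ⟨t, rfl⟩ := Nat.exists_eq_add_of_le' hs
    rw [pow_succ', Module.End.mul_apply, hxe']
  have hcomm : e * y = y * e := by
    apply mul_chainOperator he
    · rw [← C.d_σ k hk]
      exact C.pow_eq_zero _ (C.σ_lt k hk)
    · rw [hb, ← Module.End.mul_apply, ← pow_add]
      exact C.pow_w_eq_zero hl (by omega)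
  have hxb : x b = if C.d l ≤ C.d k then x (C.w l) else 0 := by
    split_ifs with h
    · rw [hb, Nat.sub_eq_zero_of_le h, pow_zero, Module.End.one_apply]
    · rw [hb, hxpow _ _ (by omega)]
  have hdb : (e ^ C.d k) b = if C.d k ≤ C.d l then (e ^ C.d l) (C.w l) else 0 := by
    rw [hb, ← Module.End.mul_apply, ← pow_add]
    split_ifs with h
    · rw [show C.d k + (C.d l - C.d k) = C.d l by omega]
    · rw [C.pow_w_eq_zero hl (by omega)]
  -- Since `x` kills the image of `e`, only the term `s = 0` of the chain operator survives.
  have hxy : ∀ i < C.p, x (y (C.w i)) = if i = k then C.ε k • x b else 0 := by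
    intro i hi
    rw [hy, chainOperator_apply, map_sum, Finset.sum_eq_single_of_mem 0 (by simp)]
    · rw [map_smul, pow_zero, Module.End.one_apply, Nat.sub_zero]
      split_ifs with h
      · subst h
        rw [C.pair_self i hi]
      · rw [C.pair_ne i k _ hi hk h (Or.inr le_rfl), zero_smul]
    · intro s _ hs
      rw [map_smul, hxpow _ _ (Nat.pos_of_ne_zero hs), smul_zero]
  have hyw : ∀ j < C.p, y ((e ^ C.d j) (C.w j)) = if j = k then C.ε k • (e ^ C.d k) b else 0 := by
    intro j hj
    rw [hy, chainOperator_apply, Finset.sum_eq_single_of_mem (C.d k) (by simp)]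
    · rw [Nat.sub_self, pow_zero, Module.End.one_apply, C.pair_top k j hk hj]
      split_ifs
      · rfl
      · rw [zero_smul]
    · intro s hs hne
      rw [Finset.mem_range] at hs
      rw [← Module.End.mul_apply, ← pow_add, C.pow_w_eq_zero hj (by omega), map_zero, zero_smul]
  have hyx : ∀ i < C.p, y (x (C.w i)) = ω (C.w (C.σ k)) (x (C.w i)) • (e ^ C.d k) b := by
    intro i hi
    conv_lhs => rw [C.eq_sum_of_apply_eq_zero hω he (hex' (C.w i)), map_sum]
    rw [Finset.sum_eq_single_of_mem k (Finset.mem_range.2 hk)]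
    · rw [map_smul, hyw k hk, if_pos rfl, smul_smul]
      congr 1
      linear_combination ω (C.w (C.σ k)) (x (C.w i)) * C.ε_mul_self k hk
    · intro j hj hne
      rw [map_smul, hyw j (Finset.mem_range.1 hj), if_neg hne, smul_zero]
  have key := hx.2 y hcomm
  rw [map_sub, sub_eq_zero] at key
  have e1 : C.tensorForm D (x * y) = if C.d l ≤ C.d k then C.ε k * ∑ j ∈ Finset.range C.p,
      D k (C.σ j) * ω (C.w (C.σ j)) (x (C.w l)) else 0 := by
    rw [tensorForm_apply, Finset.sum_eq_single_of_mem k (Finset.mem_range.2 hk)]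
    · rw [sum_range_σ]
      simp only [Module.End.mul_apply]
      rw [hxy k hk, if_pos rfl, hxb]
      split_ifs
      · rw [Finset.mul_sum]
        refine Finset.sum_congr rfl fun j _ => ?_
        rw [map_smul, smul_eq_mul]
        ring
      · simp
    · intro i hi hne
      refine Finset.sum_eq_zero fun m _ => ?_
      rw [Module.End.mul_apply, hxy i (Finset.mem_range.1 hi), if_neg hne, map_zero, mul_zero]
  have e2 : C.tensorForm D (y * x) = if C.d k ≤ C.d l then (∑ i ∈ Finset.range C.p,
      ω (C.w (C.σ k)) (x (C.w i)) * D i (C.σ l)) * C.ε l else 0 := by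
    rw [tensorForm_apply]
    split_ifs with h
    · rw [Finset.sum_mul]
      refine Finset.sum_congr rfl fun i hi => ?_
      rw [sum_range_σ, Module.End.mul_apply, hyx i (Finset.mem_range.1 hi), hdb, if_pos h,
        Finset.sum_eq_single_of_mem l (Finset.mem_range.2 hl)]
      · rw [map_smul, C.pair_self l hl, smul_eq_mul]
        ring
      · intro j hj hne
        rw [map_smul, C.pair_top j l (Finset.mem_range.1 hj) hl, if_neg hne.symm, smul_zero,
          mul_zero]
    · refine Finset.sum_eq_zero fun i hi => Finset.sum_eq_zero fun m _ => ?_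
      rw [Module.End.mul_apply, hyx i (Finset.mem_range.1 hi), hdb, if_neg h, smul_zero, map_zero,
        mul_zero]
  rw [← e1, ← e2, key]

end SymplecticChains

/-- A plane of linear functions on the endomorphism ring, vanishing on self-adjoint elements, all
of whose nonzero elements define forms on the commutant of `e` with small kernels. -/
theorem exists_plane_finrank_commutantKernel_le [IsAlgClosed K] [FiniteDimensional K V]
    (h2 : (2 : K) ≠ 0) {ω : V →ₗ[K] V →ₗ[K] K} {e : End K V} (hnil : IsNilpotent e)
    (hskew : ∀ v w, ω v w = - ω w v) (he : ∀ v w, ω (e v) w = - ω v (e w))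
    (hω : ∀ v, (∀ w, ω w v = 0) → v = 0) :
    ∃ α β : Dual K (End K V),
      (∀ x : End K V, (∀ v w, ω (x v) w = ω v (x w)) → α x = 0 ∧ β x = 0) ∧
      finrank K (commutantKernel e α) ≤ finrank K V ∧
      ∀ t : K, finrank K (commutantKernel e (t • α + β)) ≤ finrank K V := by
  obtain ⟨C⟩ := nonempty_symplecticChains_of_invariant h2 hnil hskew he ⊤ (fun _ _ => trivial)
    (fun v _ h => hω v fun w => h w trivial)
  obtain ⟨z, hz, hzi⟩ := exists_sq_injective K
  -- Constant on orbits of `σ`, so that `A` is symmetric; different orbits get different squares.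
  let a : ℕ → K := fun i => z (min i (C.σ i))
  have ha : ∀ i < C.p, a (C.σ i) = a i := by
    intro i hi
    simp only [a]
    rw [C.σ_σ i hi, min_comm]
  have hσinj : ∀ i j, i < C.p → j < C.p → C.σ i = C.σ j → i = j := by
    intro i j hi hj h
    rw [← C.σ_σ i hi, h, C.σ_σ j hj]
  let A : ℕ → ℕ → K := fun i m => if C.σ i = m then a i else 0
  -- The first summand puts ones on the superdiagonal of `B k (σ j)`; the second makes `B`
  -- symmetric, so that the function vanishes on self-adjoint elements.
  let B : ℕ → ℕ → K := fun i m => (if C.σ m = i + 1 then 1 else 0) + if C.σ i = m + 1 then 1 else 0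
  have hA : ∀ i m, i < C.p → m < C.p → A i m = A m i := by
    intro i m hi hm
    by_cases h : C.σ i = m
    · subst h
      simp only [A, if_true]
      rw [C.σ_σ i hi, if_pos rfl, ha i hi]
    · have h' : C.σ m ≠ i := by
        rintro rfl
        exact h (C.σ_σ m hm)
      simp only [A, if_neg h, if_neg h']
  have hB : ∀ i m, i < C.p → m < C.p → B i m = B m i := fun i m _ _ => add_comm _ _
  refine ⟨C.tensorForm A, C.tensorForm B, fun x hx => ⟨C.tensorForm_eq_zero h2 hskew hA hx,
    C.tensorForm_eq_zero h2 hskew hB hx⟩, ?_, fun t => ?_⟩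
  · refine finrank_commutantKernel_le hnil (∑ j ∈ Finset.range C.p, ω (C.w (C.σ j)))
      fun x hx hex hΦ => C.eq_zero_of_pair_eq_zero hω he hex hx.1 ?_
    refine eq_zero_of_diagonal (m := a) (c := fun k j => A k (C.σ j))
      (F := fun l j => ω (C.w (C.σ j)) (x (C.w l))) C.ε_mul_self ?_ (fun k _ => hz _) ?_
      (C.sylvester_equation hω he hx hex) ?_
    · intro k j hk hj
      by_cases h : k = j
      · simp [A, h]
      · simp only [A, if_neg h, if_neg fun h' => h (hσinj k j hk hj h')]
    · intro k l hk hl h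
      have hsq : z (min k (C.σ k)) ^ 2 = z (min l (C.σ l)) ^ 2 := by
        have h1 := congrArg (fun u => u * u) h
        simp only [a] at h1
        linear_combination h1 - z (min k (C.σ k)) ^ 2 * C.ε_mul_self k hk +
          z (min l (C.σ l)) ^ 2 * C.ε_mul_self l hl
      have hmin := hzi hsq
      by_contra hne
      -- Equal squares force the same `σ`-orbit; inside an orbit of two elements the signs `ε` are
      -- opposite.
      have hlk : l = C.σ k := by
        have h3 := C.σ_σ k hk
        have h4 := C.σ_σ l hl
        rcases min_choice k (C.σ k) with h1 | h1 <;> rcases min_choice l (C.σ l) with h5 | h5 <;>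
          rw [h1, h5] at hmin
        · exact (hne hmin).elim
        · rw [hmin, h4]
        · exact hmin.symm
        · exact (hne (hσinj k l hk hl hmin)).elim
      subst hlk
      rw [C.ε_σ k hk (Ne.symm hne), ha k hk] at h
      have h5 : 2 * (C.ε k * a k) = 0 := by linear_combination h
      have h6 : C.ε k ≠ 0 := fun h0 => by
        have := C.ε_mul_self k hk
        rw [h0, zero_mul] at this
        exact zero_ne_one this
      exact mul_ne_zero h2 (mul_ne_zero h6 (hz _)) h5
    · intro l _
      have := hΦ (C.w l)
      rwa [LinearMap.sum_apply] at this
  · have hlin : t • C.tensorForm A + C.tensorForm B =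
        C.tensorForm fun i m => t * A i m + B i m := by
      ext x
      simp only [LinearMap.add_apply, LinearMap.smul_apply, C.tensorForm_apply, smul_eq_mul,
        Finset.mul_sum, ← Finset.sum_add_distrib]
      refine Finset.sum_congr rfl fun i _ => Finset.sum_congr rfl fun m _ => ?_
      ring
    rw [hlin]
    refine finrank_commutantKernel_le hnil (ω (C.w (C.σ 0)))
      fun x hx hex hΦ => C.eq_zero_of_pair_eq_zero hω he hex hx.1 ?_
    refine eq_zero_of_hessenberg (c := fun k j => t * A k (C.σ j) + B k (C.σ j))
      (F := fun l j => ω (C.w (C.σ j)) (x (C.w l))) C.anti ?_ ?_ ?_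
      (C.sylvester_equation hω he hx hex) (fun l _ => hΦ _)
    · intro i hi h0
      have := C.ε_mul_self i hi
      rw [h0, zero_mul] at this
      exact zero_ne_one this
    · intro k j hk hj hkj
      have h1 : C.σ k ≠ C.σ j := fun h => by
        have := hσinj k j hk hj h
        omega
      have h2 : C.σ (C.σ j) ≠ k + 1 := by
        rw [C.σ_σ j hj]
        omega
      -- Here it matters that `σ` moves indices by at most one: the symmetrising summand then stays
      -- within the Hessenberg range.
      have h3 : C.σ k ≠ C.σ j + 1 := by
        have := C.σ_le k hk
        have := C.le_σ j hj
        omega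
      simp [A, B, h1, h2, h3]
    · intro k hk
      have h1 : C.σ k ≠ C.σ (k + 1) := fun h => by
        have := hσinj k (k + 1) (by omega) hk h
        omega
      simp only [A, B, if_neg h1, C.σ_σ (k + 1) hk, if_true, mul_zero, zero_add]
      -- The superdiagonal entry is `1` or `2`, nonzero outside characteristic two.
      split_ifs
      · norm_num
        exact h2
      · simp

end UpperBound

/-! ### Descent to the symplectic Lie algebra and conclusion. -/

section Symplectic

variable {K : Type*} [Field K]

theorem eq_zero_of_mem_adjointEigenspace_of_mem_neg {n : Type*} [Fintype n] [DecidableEq n]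
    (h2 : (2 : K) ≠ 0) {c : K} (hc : c * c = 1)
    {x : Matrix (n ⊕ n) (n ⊕ n) K} (hx : x ∈ adjointEigenspace c)
    (hx' : x ∈ adjointEigenspace (-c)) : x = 0 :=
  eq_zero_of_trace_mul_eq_zero h2 hc hx fun _ hz =>
    trace_mul_eq_zero_of_mem_adjointEigenspace h2 (by rw [neg_mul, hc]) hx' hz

variable {n : ℕ}

theorem adjointProj_commute (h2 : (2 : K) ≠ 0) {c : K} (hc : c * c = 1)
    {e z : Matrix (Fin n ⊕ Fin n) (Fin n ⊕ Fin n) K} (he : e ∈ adjointEigenspace (-1 : K))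
    (hz : e * z = z * e) : e * adjointProj c z = adjointProj c z * e := by
  have h1 := commutator_mem_adjointEigenspace he (adjointProj_mem hc z)
  have h3 := commutator_mem_adjointEigenspace he
    (adjointProj_mem (c := -c) (by rw [neg_mul_neg, hc]) z)
  rw [neg_one_mul, neg_neg] at h1 h3
  rw [← adjointProj_add h2 c z, mul_add, add_mul] at hz
  have h4 : e * adjointProj c z - adjointProj c z * e =
      -(e * adjointProj (-c) z - adjointProj (-c) z * e) := by
    rw [eq_neg_iff_add_eq_zero, ← sub_eq_zero.2 hz]
    abel
  rw [← sub_eq_zero]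
  refine eq_zero_of_mem_adjointEigenspace_of_mem_neg h2 hc h1 ?_
  rw [h4]
  exact neg_mem h3

/-- The two components of an element commuting with `e` commute with `e`. The commutator of `x` with
the component in the opposite eigenspace is self-adjoint, and `γ` vanishes there. -/
theorem centralKernel_le_comap_commutantKernel (h2 : (2 : K) ≠ 0) {c : K} (hc : c * c = 1)
    {e : Matrix (Fin n ⊕ Fin n) (Fin n ⊕ Fin n) K} (he : e ∈ adjointEigenspace (-1 : K))
    (γ : Dual K (End K (Fin n ⊕ Fin n → K)))
    (hγ : ∀ x ∈ adjointEigenspace (n := Fin n) (1 : K), γ (toLinAlgEquiv' x) = 0) :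
    centralKernel c e (γ ∘ₗ toLinAlgEquiv'.toLinearMap) ≤
      (commutantKernel (toLinAlgEquiv' e) γ).comap toLinAlgEquiv'.toLinearMap := by
  rintro x ⟨hx, hxe, hxγ⟩
  refine ⟨?_, fun y hy => ?_⟩
  · simp only [AlgEquiv.toLinearMap_apply]
    rw [← map_mul, hxe, map_mul]
  · obtain ⟨z, rfl⟩ := (toLinAlgEquiv' (R := K) (n := Fin n ⊕ Fin n)).surjective y
    rw [← map_mul, ← map_mul] at hy
    have hz : e * z = z * e := toLinAlgEquiv'.injective hy
    simp only [AlgEquiv.toLinearMap_apply]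
    rw [← map_mul, ← map_mul, ← map_sub, ← adjointProj_add h2 c z, mul_add, add_mul,
      add_sub_add_comm, map_add, map_add]
    have h1 := hxγ _ (adjointProj_mem hc z) (adjointProj_commute h2 hc he hz)
    have h3 := commutator_mem_adjointEigenspace hx
      (adjointProj_mem (c := -c) (by rw [neg_mul_neg, hc]) z)
    rw [mul_neg, hc, neg_neg] at h3
    rw [hγ _ h3, add_zero]
    exact h1

/-- The self-adjoint and symplectic kernels meet in zero inside a space of dimension at most `2n`,
and the former already has dimension at least `n`. -/
theorem finrank_centralKernel_le [IsAlgClosed K] (h2 : (2 : K) ≠ 0)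
    {e : Matrix (Fin n ⊕ Fin n) (Fin n ⊕ Fin n) K} (he : e ∈ adjointEigenspace (-1 : K))
    (γ : Dual K (End K (Fin n ⊕ Fin n → K)))
    (hγ : ∀ x ∈ adjointEigenspace (n := Fin n) (1 : K), γ (toLinAlgEquiv' x) = 0)
    (h : finrank K (commutantKernel (toLinAlgEquiv' e) γ) ≤ finrank K (Fin n ⊕ Fin n → K)) :
    finrank K (centralKernel (-1) e (γ ∘ₗ toLinAlgEquiv'.toLinearMap)) ≤ n := by
  have m1 := centralKernel_le_comap_commutantKernel h2 (c := 1) (by norm_num) he γ hγ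
  have m2 := centralKernel_le_comap_commutantKernel h2 (c := -1) (by norm_num) he γ hγ
  have h3 := Submodule.finrank_mono (sup_le m1 m2)
  have h4 := Submodule.finrank_sup_add_finrank_inf_eq
    (centralKernel 1 e (γ ∘ₗ toLinAlgEquiv'.toLinearMap))
    (centralKernel (-1) e (γ ∘ₗ toLinAlgEquiv'.toLinearMap))
  have h5 : centralKernel 1 e (γ ∘ₗ toLinAlgEquiv'.toLinearMap) ⊓
      centralKernel (-1) e (γ ∘ₗ toLinAlgEquiv'.toLinearMap) = ⊥ := by
    rw [eq_bot_iff]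
    intro x hx
    exact (Submodule.mem_bot K).2 (eq_zero_of_mem_adjointEigenspace_of_mem_neg h2 (one_mul 1)
      hx.1.1 hx.2.1)
  rw [h5, finrank_bot, add_zero] at h4
  have h6 := le_finrank_centralKernel h2 (Or.inl rfl) he
    (γ ∘ₗ toLinAlgEquiv'.toLinearMap) fun x hx => hγ x hx
  have h7 : finrank K ((commutantKernel (toLinAlgEquiv' e) γ).comap
      (toLinAlgEquiv' (R := K) (n := Fin n ⊕ Fin n)).toLinearMap) ≤
      finrank K (commutantKernel (toLinAlgEquiv' e) γ) := by
    refine LinearMap.finrank_le_finrank_of_injective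
      (f := (toLinAlgEquiv' (R := K) (n := Fin n ⊕ Fin n)).toLinearMap.restrict
        fun x hx => hx) ?_
    rw [LinearMap.injective_restrict_iff, Submodule.disjoint_def]
    intro x _ hx
    exact toLinAlgEquiv'.injective (by simpa using hx)
  have h8 : finrank K (Fin n ⊕ Fin n → K) = n + n := by simp
  omega

/-- The inclusion of a centraliser in the symplectic Lie algebra into the matrices. -/
def centraliserSubtype (e : LieAlgebra.Symplectic.sp (Fin n) K) :
    centraliser K e →ₗ[K] Matrix (Fin n ⊕ Fin n) (Fin n ⊕ Fin n) K :=
  (LieAlgebra.Symplectic.sp (Fin n) K).toSubmodule.subtype ∘ₗ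
    (centraliser K e).toSubmodule.subtype

theorem centraliserSubtype_injective (e : LieAlgebra.Symplectic.sp (Fin n) K) :
    Function.Injective (centraliserSubtype e) :=
  Subtype.val_injective.comp Subtype.val_injective

theorem mem_range_centraliserSubtype (e : LieAlgebra.Symplectic.sp (Fin n) K)
    (x : Matrix (Fin n ⊕ Fin n) (Fin n ⊕ Fin n) K) :
    (∃ y, centraliserSubtype e y = x) ↔
      x ∈ adjointEigenspace (-1 : K) ∧ e.1 * x = x * e.1 := by
  constructor
  · rintro ⟨y, rfl⟩
    refine ⟨mem_sp_iff.1 y.1.2, ?_⟩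
    have h : ⁅e, y.1⁆ = 0 := y.2
    exact sub_eq_zero.1 (congrArg Subtype.val h)
  · rintro ⟨h1, h2⟩
    refine ⟨⟨⟨x, mem_sp_iff.2 h1⟩, ?_⟩, rfl⟩
    exact Subtype.ext (sub_eq_zero.2 h2)

theorem finrank_stabiliser_comp_centraliserSubtype (e : LieAlgebra.Symplectic.sp (Fin n) K)
    (γ : Dual K (Matrix (Fin n ⊕ Fin n) (Fin n ⊕ Fin n) K)) :
    finrank K (stabiliser (γ ∘ₗ centraliserSubtype e)) =
      finrank K (centralKernel (-1) e.1 γ) := by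
  have h : (stabiliser (γ ∘ₗ centraliserSubtype e)).map (centraliserSubtype e) =
      centralKernel (-1) e.1 γ := by
    ext x
    constructor
    · rintro ⟨y, hy, rfl⟩
      have h1 := (mem_range_centraliserSubtype e _).1 ⟨y, rfl⟩
      refine ⟨h1.1, h1.2, fun z hz hz' => ?_⟩
      obtain ⟨w, rfl⟩ := (mem_range_centraliserSubtype e z).2 ⟨hz, hz'⟩
      exact hy w
    · rintro ⟨h1, h3, h4⟩
      obtain ⟨y, rfl⟩ := (mem_range_centraliserSubtype e x).2 ⟨h1, h3⟩
      refine ⟨y, fun w => ?_, rfl⟩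
      have h5 := (mem_range_centraliserSubtype e _).1 ⟨w, rfl⟩
      exact h4 _ h5.1 h5.2
  rw [← h]
  exact (Submodule.equivMapOfInjective _ (centraliserSubtype_injective e) _).finrank_eq

/-- The index of a centraliser in the symplectic Lie algebra is at least the rank. -/
theorem le_index_centraliser [IsAlgClosed K] (h2 : (2 : K) ≠ 0)
    (e : LieAlgebra.Symplectic.sp (Fin n) K) : n ≤ index K (centraliser K e) := by
  refine le_ciInf fun γ => ?_
  obtain ⟨γ₁, hγ₁⟩ := LinearMap.dualMap_surjective_of_injective (centraliserSubtype_injective e) γ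
  -- Composing with the projection gives an extension of `γ` that vanishes on self-adjoint matrices.
  have h : γ = (γ₁ ∘ₗ adjointProj (-1)) ∘ₗ centraliserSubtype e := by
    rw [← hγ₁]
    ext x
    have h1 := ((mem_range_centraliserSubtype e _).1 ⟨x, rfl⟩).1
    simp only [LinearMap.dualMap_apply, LinearMap.comp_apply]
    rw [adjointProj_of_mem h2 (by norm_num) h1]
  rw [h, finrank_stabiliser_comp_centraliserSubtype]
  refine le_finrank_centralKernel h2 (Or.inr rfl) (mem_sp_iff.1 e.2) _ fun x hx => ?_
  have h3 := adjointProj_add h2 1 x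
  rw [adjointProj_of_mem h2 (one_mul 1) hx, add_eq_left] at h3
  rw [LinearMap.comp_apply, h3, map_zero]

theorem toLinearMap₂'_J_apply {c : K} {x : Matrix (Fin n ⊕ Fin n) (Fin n ⊕ Fin n) K}
    (hx : x ∈ adjointEigenspace c) (v w : Fin n ⊕ Fin n → K) :
    toLinearMap₂' K (J (Fin n) K) (toLinAlgEquiv' x v) w =
      c * toLinearMap₂' K (J (Fin n) K) v (toLinAlgEquiv' x w) := by
  rw [mem_adjointEigenspace] at hx
  rw [toLinearMap₂'_apply', toLinearMap₂'_apply', toLinAlgEquiv'_apply, toLinAlgEquiv'_apply,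
    ← vecMul_transpose, ← dotProduct_mulVec, mulVec_mulVec, hx, smul_mulVec, dotProduct_smul,
    smul_eq_mul, mulVec_mulVec]

theorem two_le_zariskiCodim_singularLocus_centraliser [IsAlgClosed K] (h2 : (2 : K) ≠ 0)
    (e : LieAlgebra.Symplectic.sp (Fin n) K) (he : IsNilpotent e.1) :
    2 ≤ zariskiCodim (singularLocus K (centraliser K e)) := by
  have hmem := mem_sp_iff.1 e.2
  obtain ⟨α, β, hself, hα, hβ⟩ := exists_plane_finrank_commutantKernel_le h2
    (ω := toLinearMap₂' K (J (Fin n) K)) (e := toLinAlgEquiv' e.1)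
    (he.map toLinAlgEquiv') (fun v w => by
      rw [toLinearMap₂'_apply', toLinearMap₂'_apply', dotProduct_mulVec, ← mulVec_transpose,
        J_transpose, neg_mulVec, neg_dotProduct, dotProduct_comm])
    (fun v w => by rw [toLinearMap₂'_J_apply hmem, neg_one_mul])
    (fun v h => by
      have h1 : J (Fin n) K *ᵥ v = 0 := by
        ext i
        have := h (Pi.single i 1)
        rwa [toLinearMap₂'_apply', single_one_dotProduct] at this
      have h3 := congrArg (fun u => J (Fin n) K *ᵥ u) h1
      simpa [mulVec_mulVec, J_squared, neg_mulVec] using h3)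
  have hz : ∀ x ∈ adjointEigenspace (n := Fin n) (1 : K),
      α (toLinAlgEquiv' x) = 0 ∧ β (toLinAlgEquiv' x) = 0 := fun x hx =>
    hself _ fun v w => by rw [toLinearMap₂'_J_apply hx, one_mul]
  have key : ∀ γ : Dual K (End K (Fin n ⊕ Fin n → K)),
      (∀ x ∈ adjointEigenspace (n := Fin n) (1 : K), γ (toLinAlgEquiv' x) = 0) →
      finrank K (commutantKernel (toLinAlgEquiv' e.1) γ) ≤ finrank K (Fin n ⊕ Fin n → K) →
      finrank K (stabiliser ((γ ∘ₗ toLinAlgEquiv'.toLinearMap) ∘ₗ centraliserSubtype e)) ≤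
        index K (centraliser K e) := fun γ h3 h4 => by
    rw [finrank_stabiliser_comp_centraliserSubtype]
    exact (finrank_centralKernel_le h2 hmem γ h3 h4).trans (le_index_centraliser h2 e)
  refine two_le_zariskiCodim_singularLocus
    ((α ∘ₗ toLinAlgEquiv'.toLinearMap) ∘ₗ centraliserSubtype e)
    ((β ∘ₗ toLinAlgEquiv'.toLinearMap) ∘ₗ centraliserSubtype e)
    (key α (fun x hx => (hz x hx).1) hα) fun t => ?_
  exact key (t • α + β) (fun x hx => by
    rw [LinearMap.add_apply, LinearMap.smul_apply, (hz x hx).1, (hz x hx).2, smul_zero, add_zero])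
    (hβ t)

end Symplectic

end LinearFunctions


theorem theorem3p7 {K : Type*} [Field K] [IsAlgClosed K] (hchar : ringChar K ≠ 2)
    (n : ℕ) (hn : 2 ≤ n) (e : LieAlgebra.Symplectic.sp (Fin n) K)
    (he : IsNilpotent (e : Matrix (Fin n ⊕ Fin n) (Fin n ⊕ Fin n) K)) :
    2 ≤ LinearFunctions.zariskiCodim
      (LinearFunctions.singularLocus K (LinearFunctions.centraliser K e)) :=
  LinearFunctions.two_le_zariskiCodim_singularLocus_centraliser (Ring.two_ne_zero hchar) e he
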